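/- Fix $n\ge 0$. Let $\mathfrak g=\mathfrak g_{\bar 0}\oplus\mathfrak g_{\bar 1}=\mathfrak q(n)$ be the complex queer Lie superalgebra of block matrices $\begin{pmatrix}A&B\\B&A\end{pmatrix}$, where $A,B$ are complex $n\times n$ matrices, $\mathfrak g_{\bar 0}\cong\mathfrak{gl}(n)$ is given by $B=0$ and $\mathfrak g_{\bar 1}$ by $A=0$. Let $\mathfrak h=\mathfrak h_{\bar 0}\oplus\mathfrak h_{\bar 1}$ ($A,B$ diagonal), $\mathfrak b$ ($A,B$ upper triangular) and $\mathfrak n^+$ ($A,B$ strictly upper triangular) be the standard subalgebras, let $\delta_1,\dots,\delta_n$ be the standard basis of $\mathfrak h_{\bar 0}^*$, and let $\Phi^+=\{\delta_i-\delta_j : 1\le i<j\le n\}$. For a $\mathfrak g$-supermodule $M$ with finite-dimensional weight spaces $M_\mu=M_{\mu,\bar 0}\oplus M_{\mu,\bar 1}$ with respect to $\mathfrak h_{\bar 0}$, put $\operatorname{sch}M=\sum_\mu(\dim M_{\mu,\bar 0}-\dim M_{\mu,\bar 1})e^\mu$. For $\lambda\in\mathfrak h_{\bar 0}^*$ choose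 a subspace $\mathfrak h'_{\bar 1}$ of $\mathfrak h_{\bar 1}$ that is maximal isotropic for the form $\lambda([\cdot,\cdot])$, let $I_\lambda$ be the $\mathfrak h$-module induced from the one-dimensional even $(\mathfrak h_{\bar 0}\oplus\mathfrak h'_{\bar 1})$-module on which $\mathfrak h_{\bar 0}$ acts by $\lambda$ and $\mathfrak h'_{\bar 1}$ by $0$, let $\Delta(\lambda)=\operatorname{Ind}_{\mathfrak b}^{\mathfrak g}I_\lambda$ be the Verma module ($\mathfrak n^+$ acting on $I_\lambda$ by $0$), and let $L(\lambda)$ be its irreducible quotient, that is, the quotient by the sum of all proper graded submodules. Let $\mathcal O$ be the category of finitely generated, $\mathfrak h_{\bar 0}$-semisimple, $U(\mathfrak b)$-locally finite $\mathfrak g$-supermodules. 1. Let $\lambda\in\mathfrak h_{\bar 0}^*$ be such that $\lambda\ne\sum_{\alpha\in I}\alpha$ for every subset $I\subseteq\Phi^+$. Then, for every choice of $\mathfrak h'_{\bar 1}$, the trivial one-dimensional $\mathfrak{gl}(n)$-module $L^0(0)$ is not a composition factor of the restriction of $L(\lambda)$ to $\mathfrak g_{\bar 0}=\mathfrak{gl}(n)$,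 that is, $[L(\lambda):L^0(0)]=0$. Moreover $L(\lambda)$ has finite-dimensional weight spaces, and $\operatorname{sch}L(\lambda)=0$. 2. Consequently the Gorelik-Grantcharov-Mazorchuk conjecture, which asserts that $\operatorname{sch}L(\lambda)=0$ for all $\lambda\neq0$, holds for all but finitely many $\lambda\in\mathfrak h_{\bar 0}^*$. In terms of the irreducible objects of $\mathcal O$: there is a finite set $S\subset\mathfrak h_{\bar 0}^*$ such that every irreducible $M\in\mathcal O$ either has a highest weight in $S$ (there are $\lambda\in S$ and $0\ne v\in M_\lambda$ with $\mathfrak n^+v=0$), or has finite-dimensional weight spaces and $\operatorname{sch}M=0$. -/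

import Mathlib

/-!  The queer Lie superalgebra q(n), its supermodules, and supercharacters. -/

namespace Queer

/-- The general linear Lie algebra `gl(n)` over `ℂ`. -/
abbrev Gl (n : ℕ) : Type := Matrix (Fin n) (Fin n) ℂ

/-- The Lie bracket of `gl(n)` is the commutator of matrices. -/
@[reducible] noncomputable instance (n : ℕ) : LieRing (Gl n) := LieRing.ofAssociativeRing

/-- The underlying superspace of `q(n)`: the pair `(A, B)` stands for the block matrix
`[A, B; B, A]` in `gl(n|n)`; `(A, 0)` is even and `(0, B)` is odd. -/
abbrev Alg (n : ℕ) : Type := Gl n × Gl n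

/-- The realisation of `q(n)` inside `gl(n|n)`. -/
def toBlock {n : ℕ} (x : Alg n) : Matrix (Fin n ⊕ Fin n) (Fin n ⊕ Fin n) ℂ :=
  Matrix.fromBlocks x.1 x.2 x.2 x.1

/-- The relations `x y - (-1)^{|x||y|} y x = [x, y]` of the enveloping algebra of `q(n)`, for
homogeneous `x`, `y`. The brackets are the supercommutators of block matrices, see `toBlock_ee`,
`toBlock_eo`, `toBlock_oo` below. -/
inductive Rel (n : ℕ) : TensorAlgebra ℂ (Alg n) → TensorAlgebra ℂ (Alg n) → Prop
  | ee (A A' : Gl n) : Rel n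
      (TensorAlgebra.ι ℂ ((A, 0) : Alg n) * TensorAlgebra.ι ℂ ((A', 0) : Alg n)
        - TensorAlgebra.ι ℂ ((A', 0) : Alg n) * TensorAlgebra.ι ℂ ((A, 0) : Alg n))
      (TensorAlgebra.ι ℂ ((A * A' - A' * A, 0) : Alg n))
  | eo (A B : Gl n) : Rel n
      (TensorAlgebra.ι ℂ ((A, 0) : Alg n) * TensorAlgebra.ι ℂ ((0, B) : Alg n)
        - TensorAlgebra.ι ℂ ((0, B) : Alg n) * TensorAlgebra.ι ℂ ((A, 0) : Alg n))
      (TensorAlgebra.ι ℂ ((0, A * B - B * A) : Alg n))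
  | oo (B B' : Gl n) : Rel n
      (TensorAlgebra.ι ℂ ((0, B) : Alg n) * TensorAlgebra.ι ℂ ((0, B') : Alg n)
        + TensorAlgebra.ι ℂ ((0, B') : Alg n) * TensorAlgebra.ι ℂ ((0, B) : Alg n))
      (TensorAlgebra.ι ℂ ((B * B' + B' * B, 0) : Alg n))

theorem toBlock_ee {n : ℕ} (A A' : Gl n) :
    toBlock ((A * A' - A' * A, 0) : Alg n)
      = toBlock (A, 0) * toBlock (A', 0) - toBlock (A', 0) * toBlock (A, 0) := by
  simp [toBlock, Matrix.fromBlocks_multiply, sub_eq_add_neg, Matrix.fromBlocks_neg,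
    Matrix.fromBlocks_add]

theorem toBlock_eo {n : ℕ} (A B : Gl n) :
    toBlock ((0, A * B - B * A) : Alg n)
      = toBlock (A, 0) * toBlock (0, B) - toBlock (0, B) * toBlock (A, 0) := by
  simp [toBlock, Matrix.fromBlocks_multiply, sub_eq_add_neg, Matrix.fromBlocks_neg,
    Matrix.fromBlocks_add]

theorem toBlock_oo {n : ℕ} (B B' : Gl n) :
    toBlock ((B * B' + B' * B, 0) : Alg n)
      = toBlock (0, B) * toBlock (0, B') + toBlock (0, B') * toBlock (0, B) := by
  simp [toBlock, Matrix.fromBlocks_multiply, Matrix.fromBlocks_add]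

/-- The universal enveloping algebra `U(q(n))`. -/
def U (n : ℕ) : Type := RingQuot (Rel n)

noncomputable instance (n : ℕ) : Ring (U n) := inferInstanceAs (Ring (RingQuot (Rel n)))

noncomputable instance (n : ℕ) : Algebra ℂ (U n) :=
  inferInstanceAs (Algebra ℂ (RingQuot (Rel n)))

/-- The projection of the tensor algebra onto `U(q(n))`. -/
noncomputable def mk (n : ℕ) : TensorAlgebra ℂ (Alg n) →ₐ[ℂ] U n := RingQuot.mkAlgHom ℂ (Rel n)

/-- The canonical map `q(n) → U(q(n))`. -/
noncomputable def ι (n : ℕ) : Alg n →ₗ[ℂ] U n := (mk n).toLinearMap ∘ₗ TensorAlgebra.ι ℂ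

theorem mk_rel {n : ℕ} {x y : TensorAlgebra ℂ (Alg n)} (h : Rel n x y) : mk n x = mk n y :=
  RingQuot.mkAlgHom_rel ℂ h

/-- The even element `[A, 0; 0, A]`; for `A = E_{ij}` this is `e_{ij}`. -/
noncomputable def ev {n : ℕ} (A : Gl n) : U n := ι n (A, 0)

/-- The odd element `[0, B; B, 0]`; for `B = E_{ij}` this is the odd `e_{ij}`. -/
noncomputable def od {n : ℕ} (B : Gl n) : U n := ι n (0, B)

theorem ev_bracket {n : ℕ} (A A' : Gl n) : 
    ev A * ev A' - ev A' * ev A = ev (A * A' - A' * A) := by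
  have h := mk_rel (Rel.ee A A')
  rwa [map_sub, map_mul, map_mul] at h

theorem ev_od {n : ℕ} (A B : Gl n) :
    ev A * od B - od B * ev A = od (A * B - B * A) := by
  have h := mk_rel (Rel.eo A B)
  rwa [map_sub, map_mul, map_mul] at h

theorem od_od {n : ℕ} (B B' : Gl n) :
    od B * od B' + od B' * od B = ev (B * B' + B' * B) := by
  have h := mk_rel (Rel.oo B B')
  rwa [map_add, map_mul, map_mul] at h

/-- The linear map `(A, B) ↦ (A, -B)`. -/
def flip (n : ℕ) : Alg n →ₗ[ℂ] Alg n :=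
  LinearMap.prodMap LinearMap.id (-LinearMap.id)

/-- The parity automorphism of `U(q(n))`: the identity on even, minus the identity on odd
elements. -/
noncomputable def sigma (n : ℕ) : U n →ₐ[ℂ] U n :=
  RingQuot.liftAlgHom ℂ ⟨TensorAlgebra.lift ℂ (ι n ∘ₗ flip n), by
    intro x y h
    cases h with
    | ee A A' =>
      have := ev_bracket A A'
      simpa [flip, ev] using this
    | eo A B =>
      have := congrArg Neg.neg (ev_od A B)
      have e : ∀ B : Gl n, ι n (0, -B) = - ι n (0, B) := fun B => by
        rw [← map_neg]; simp
      simp only [map_sub, map_mul, TensorAlgebra.lift_ι_apply, LinearMap.comp_apply, flip,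
        LinearMap.prodMap_apply, LinearMap.id_apply, LinearMap.neg_apply, neg_zero]
      simp only [ev, od] at this
      rw [show -(A * B) - -(B * A) = -(A * B - B * A) by abel]
      rw [e, e, ← this]
      noncomm_ring
    | oo B B' =>
      have := od_od B B'
      have e : ∀ B : Gl n, ι n (0, -B) = - ι n (0, B) := fun B => by
        rw [← map_neg]; simp
      simp only [map_add, map_mul, TensorAlgebra.lift_ι_apply, LinearMap.comp_apply, flip,
        LinearMap.prodMap_apply, LinearMap.id_apply, LinearMap.neg_apply, neg_zero, e]
      simp only [ev, od] at this
      rw [← this]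
      noncomm_ring⟩

theorem sigma_ι {n : ℕ} (x : Alg n) : sigma n (ι n x) = ι n (flip n x) := by
  have h := RingQuot.liftAlgHom_mkAlgHom_apply (S := ℂ) (s := Rel n)
    (f := TensorAlgebra.lift ℂ (ι n ∘ₗ flip n))
  refine (h _ (TensorAlgebra.ι ℂ x)).trans ?_
  simp

theorem sigma_ev {n : ℕ} (A : Gl n) : sigma n (ev A) = ev A := by
  simp [ev, sigma_ι, flip]

theorem sigma_od {n : ℕ} (B : Gl n) : sigma n (od B) = - od B := by
  rw [od, sigma_ι, ← map_neg]; simp [flip]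

theorem algHom_ext {n : ℕ} {R : Type*} [Ring R] [Algebra ℂ R] {f g : U n →ₐ[ℂ] R}
    (h : ∀ x, f (ι n x) = g (ι n x)) : f = g := by
  apply RingQuot.ringQuot_ext' (S := ℂ)
  apply TensorAlgebra.hom_ext
  ext x
  exacts [h (x, 0), h (0, x)]

theorem sigma_sigma {n : ℕ} (u : U n) : sigma n (sigma n u) = u := by
  have : (sigma n).comp (sigma n) = AlgHom.id ℂ (U n) := by
    apply algHom_ext
    intro x
    simp [sigma_ι, flip]
  exact DFunLike.congr_fun this u

section Modules

variable (n : ℕ) (M : Type*) [AddCommGroup M] [Module ℂ M] [Module (U n) M]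

/-- A structure of `q(n)`-supermodule on a `U(q(n))`-module: the `ℤ/2`-grading is given by its
parity operator, which is the identity on the even part and minus the identity on the odd part;
even elements of `q(n)` preserve the parity, odd ones reverse it. -/
structure SuperStr where
  /-- the parity operator -/
  par : M →ₗ[ℂ] M
  par_par : ∀ m, par (par m) = m
  par_ev : ∀ (A : Gl n) (m : M), par (ev A • m) = ev A • par m
  par_od : ∀ (B : Gl n) (m : M), par (od B • m) = - (od B • par m)

variable {n M}

/-- The even part of a supermodule. -/
def SuperStr.even (P : SuperStr n M) : Submodule ℂ M := LinearMap.ker (P.par - LinearMap.id)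

/-- The odd part of a supermodule. -/
def SuperStr.odd (P : SuperStr n M) : Submodule ℂ M := LinearMap.ker (P.par + LinearMap.id)

/-- A supermodule is the direct sum of its even and odd parts. -/
theorem SuperStr.isCompl (P : SuperStr n M) : IsCompl P.even P.odd := by
  constructor
  · rw [Submodule.disjoint_def]
    intro x hx hy
    have h1 : P.par x - x = 0 := hx
    have h2 : P.par x + x = 0 := hy
    have h3 : (2 : ℂ) • x = 0 := by
      rw [two_smul, ← sub_eq_zero.mp h1, sub_eq_zero.mp h1]
      simpa [sub_eq_zero.mp h1] using h2
    simpa using h3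
  · rw [codisjoint_iff_le_sup]
    intro x _
    refine Submodule.mem_sup.mpr ⟨(2⁻¹ : ℂ) • (x + P.par x), ?_, (2⁻¹ : ℂ) • (x - P.par x), ?_, ?_⟩
    · change P.par _ - (2⁻¹ : ℂ) • (x + P.par x) = 0
      rw [map_smul, map_add, P.par_par, add_comm, sub_self]
    · change P.par _ + (2⁻¹ : ℂ) • (x - P.par x) = 0
      rw [map_smul, map_sub, P.par_par, ← smul_add]; simp
    · module

/-- Sub-supermodules: the submodules that are graded, i.e. stable under the parity operator. -/
def SuperStr.IsGraded (P : SuperStr n M) (N : Submodule (U n) M) : Prop :=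
  ∀ m ∈ N, P.par m ∈ N

/-- Irreducible supermodules. -/
def SuperStr.IsIrreducible (P : SuperStr n M) : Prop :=
  Nontrivial M ∧ ∀ N : Submodule (U n) M, P.IsGraded N → N = ⊥ ∨ N = ⊤

/-- The sum of all proper graded submodules. -/
noncomputable def SuperStr.maxProper (P : SuperStr n M) : Submodule (U n) M :=
  sSup {N | P.IsGraded N ∧ N ≠ ⊤}

theorem SuperStr.maxProper_isGraded (P : SuperStr n M) : P.IsGraded P.maxProper := by
  intro m hm
  rw [SuperStr.maxProper, sSup_eq_iSup'] at hm
  induction hm using Submodule.iSup_induction' with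
  | mem N x hx => exact (le_sSup N.2 : N.1 ≤ _) (N.2.1 x hx)
  | zero => simp
  | add x y _ _ hx hy => rw [map_add]; exact add_mem hx hy

variable [IsScalarTower ℂ (U n) M]

/-- The quotient of a supermodule by a graded submodule. -/
noncomputable def SuperStr.quotient (P : SuperStr n M) (N : Submodule (U n) M) (hN : P.IsGraded N) :
    SuperStr n (M ⧸ N) where
  par := (Submodule.Quotient.restrictScalarsEquiv ℂ N).toLinearMap ∘ₗ
    Submodule.mapQ (N.restrictScalars ℂ) (N.restrictScalars ℂ) P.par hN ∘ₗ
    (Submodule.Quotient.restrictScalarsEquiv ℂ N).symm.toLinearMap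
  par_par := by
    rintro ⟨m⟩
    exact congrArg (Submodule.Quotient.mk (p := N)) (P.par_par m)
  par_ev := by
    rintro A ⟨m⟩
    exact congrArg (Submodule.Quotient.mk (p := N)) (P.par_ev A m)
  par_od := by
    rintro B ⟨m⟩
    exact congrArg (Submodule.Quotient.mk (p := N)) (P.par_od B m)

variable (n M)

/-- The weight space `M_μ`, for `μ = ∑ μ_i δ_i`. -/
def weightSpace (μ : Fin n → ℂ) : Submodule ℂ M where
  carrier := {m | ∀ h : Fin n → ℂ, ev (Matrix.diagonal h) • m = (∑ i, h i * μ i) • m}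
  add_mem' := fun ha hb h => by rw [smul_add, smul_add, ha h, hb h]
  zero_mem' := fun h => by simp
  smul_mem' := fun c x hx h => by
    rw [← algebraMap_smul (U n) c x, ← mul_smul, ← Algebra.commutes, mul_smul, hx h,
      smul_comm, algebraMap_smul]

/-- Every weight space is finite-dimensional, so that the supercharacter makes sense. -/
def HasFiniteWeightSpaces : Prop :=
  ∀ μ : Fin n → ℂ, FiniteDimensional ℂ (weightSpace n M μ)

variable {n M}

/-- The supercharacter `∑_μ (dim M_{μ,0} - dim M_{μ,1}) e^μ`, as the function that sends `μ` to
the coefficient of `e^μ`. -/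
noncomputable def SuperStr.sch (P : SuperStr n M) (μ : Fin n → ℂ) : ℤ :=
  (Module.finrank ℂ ↥(weightSpace n M μ ⊓ P.even) : ℤ)
    - (Module.finrank ℂ ↥(weightSpace n M μ ⊓ P.odd) : ℤ)

variable (n M)

/-- The BGG category `𝒪`: finitely generated, `h_0`-semisimple, and locally finite over the
standard Borel subalgebra `b` (upper triangular `A` and `B`). -/
structure InO : Prop where
  finite : Module.Finite (U n) M
  semisimple : ⨆ μ : Fin n → ℂ, weightSpace n M μ = ⊤
  locallyFinite : ∀ m : M, ∃ W : Submodule ℂ M, m ∈ W ∧ FiniteDimensional ℂ W ∧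
    ∀ A : Gl n, (∀ i j, j < i → A i j = 0) → ∀ w ∈ W, ev A • w ∈ W ∧ od A • w ∈ W

/-- `λ` is a highest weight of `M`: there is a nonzero vector of weight `λ` that is killed by all
positive root vectors (strictly upper triangular `A` and `B`). -/
def HasHighestWeight (lam : Fin n → ℂ) : Prop :=
  ∃ v ∈ weightSpace n M lam, v ≠ 0 ∧
    ∀ A : Gl n, (∀ i j, j ≤ i → A i j = 0) → ev A • v = 0 ∧ od A • v = 0

end Modules

/-- `U(q(n))` as a supermodule over `q(n)`. -/
noncomputable def uSuper (n : ℕ) : SuperStr n (U n) where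
  par := (sigma n).toLinearMap
  par_par := sigma_sigma
  par_ev := fun A m => by simp [sigma_ev]
  par_od := fun B m => by simp [sigma_od]

/-- A subspace of `h_1` (the odd elements with diagonal `B`, identified with `ℂ^n`) is isotropic
for the symmetric form `λ([b, b'])`, where `[b, b'] = b b' + b' b` is in `h_0`. -/
def IsIsotropic {n : ℕ} (lam : Fin n → ℂ) (H : Submodule ℂ (Fin n → ℂ)) : Prop :=
  ∀ b ∈ H, ∀ b' ∈ H, ∑ i, (b i * b' i + b' i * b i) * lam i = 0

/-- The left ideal of `U(q(n))` generated by `n⁺`, by `h - λ(h)` for `h` in `h_0`, and by the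
subspace `H` of `h_1`. -/
noncomputable def vermaIdeal (n : ℕ) (lam : Fin n → ℂ) (H : Submodule ℂ (Fin n → ℂ)) :
    Submodule (U n) (U n) :=
  Submodule.span (U n)
    ({u | ∃ A : Gl n, (∀ i j, j ≤ i → A i j = 0) ∧ (u = ev A ∨ u = od A)} ∪
     {u | ∃ h : Fin n → ℂ,
        u = ev (Matrix.diagonal h) - algebraMap ℂ (U n) (∑ i, h i * lam i)} ∪
     {u | ∃ b ∈ H, u = od (Matrix.diagonal b)})

theorem vermaIdeal_isGraded (n : ℕ) (lam : Fin n → ℂ) (H : Submodule ℂ (Fin n → ℂ)) :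
    (uSuper n).IsGraded (vermaIdeal n lam H) := by
  intro m hm
  change sigma n m ∈ _
  induction hm using Submodule.span_induction with
  | mem x hx =>
    have hx' : x ∈ vermaIdeal n lam H := Submodule.subset_span hx
    rcases hx with (⟨A, _, rfl | rfl⟩ | ⟨h, rfl⟩) | ⟨b, _, rfl⟩
    · rwa [sigma_ev]
    · rw [sigma_od]; exact neg_mem hx'
    · rwa [map_sub, sigma_ev, AlgHom.commutes]
    · rw [sigma_od]; exact neg_mem hx'
  | zero => simp
  | add x y _ _ hx hy => rw [map_add]; exact add_mem hx hy
  | smul a x _ hx =>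
    rw [smul_eq_mul, map_mul]
    exact Submodule.smul_mem _ (sigma n a) hx

/-- The Verma module `Δ(λ)`, induced to `q(n)` from the one-dimensional even module `ℂ v_λ` of
`h_0 + H + n⁺`, on which `h_0` acts by `λ` and `H`, `n⁺` by zero. Here `H` is a maximal isotropic
subspace of `h_1`. By induction in stages this is the module induced from `b` to `q(n)` from the
inflation of `I_λ`, the `h`-module induced from `ℂ v_λ`. -/
abbrev Verma (n : ℕ) (lam : Fin n → ℂ) (H : Submodule ℂ (Fin n → ℂ)) : Type :=
  U n ⧸ vermaIdeal n lam H

/-- The grading of `Δ(λ)`, in which the highest weight vector `v_λ` is even. -/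
noncomputable def vermaSuper (n : ℕ) (lam : Fin n → ℂ) (H : Submodule ℂ (Fin n → ℂ)) :
    SuperStr n (Verma n lam H) :=
  (uSuper n).quotient (vermaIdeal n lam H) (vermaIdeal_isGraded n lam H)

/-- The module `L(λ)`, the irreducible quotient of `Δ(λ)`: the quotient by the sum of all proper
graded submodules. -/
abbrev L (n : ℕ) (lam : Fin n → ℂ) (H : Submodule ℂ (Fin n → ℂ)) : Type :=
  Verma n lam H ⧸ (vermaSuper n lam H).maxProper

/-- The grading of `L(λ)`. -/
noncomputable def LSuper (n : ℕ) (lam : Fin n → ℂ) (H : Submodule ℂ (Fin n → ℂ)) :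
    SuperStr n (L n lam H) :=
  (vermaSuper n lam H).quotient _ (vermaSuper n lam H).maxProper_isGraded

/-- The set of positive roots `δ_i - δ_j`, `i < j`. -/
def posRoots (n : ℕ) : Set (Fin n → ℂ) :=
  {α | ∃ i j : Fin n, i < j ∧ α = Pi.single i 1 - Pi.single j 1}

/-- The restriction of a `q(n)`-module to the even part `gl(n)`. -/
@[reducible] noncomputable def glAction (n : ℕ) (M : Type*) [AddCommGroup M] [Module (U n) M] :
    LieRingModule (Gl n) M where
  bracket A m := ev A • m
  add_lie A B m := by
    have h : ev (A + B) = ev A + ev B := by simp [ev, ← map_add]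
    change ev (A + B) • m = ev A • m + ev B • m
    rw [h, add_smul]
  lie_add A m m' := smul_add _ m m'
  leibniz_lie A B m := by
    change ev A • ev B • m = ev (A * B - B * A) • m + ev B • ev A • m
    rw [← ev_bracket, sub_smul, mul_smul, mul_smul, sub_add_cancel]

noncomputable instance (n : ℕ) (lam : Fin n → ℂ) (H : Submodule ℂ (Fin n → ℂ)) :
    LieRingModule (Gl n) (L n lam H) := glAction n _

instance (n : ℕ) (lam : Fin n → ℂ) (H : Submodule ℂ (Fin n → ℂ)) :
    LieModule ℂ (Gl n) (L n lam H) where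
  smul_lie t A m := by
    have h : ev (t • A) = t • ev A := by
      rw [ev, ev, ← map_smul]; simp
    change ev (t • A) • m = t • ev A • m
    rw [h, smul_assoc]
  lie_smul t A m := by
    change ev A • t • m = t • ev A • m
    rw [smul_comm]

/-- The trivial one-dimensional `gl(n)`-module `L⁰(0)`. -/
def TrivialGl (_n : ℕ) : Type := ℂ

noncomputable instance (n : ℕ) : AddCommGroup (TrivialGl n) := inferInstanceAs (AddCommGroup ℂ)

noncomputable instance (n : ℕ) : Module ℂ (TrivialGl n) := inferInstanceAs (Module ℂ ℂ)

noncomputable instance (n : ℕ) : LieRingModule (Gl n) (TrivialGl n) where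
  bracket _ _ := 0
  add_lie _ _ _ := (add_zero 0).symm
  lie_add _ _ _ := (add_zero 0).symm
  leibniz_lie _ _ _ := (add_zero 0).symm

instance (n : ℕ) : LieModule ℂ (Gl n) (TrivialGl n) where
  smul_lie t _ _ := (smul_zero t).symm
  lie_smul t _ _ := (smul_zero t).symm

/-- The multiplicity `[M : N]` of an irreducible module `N` in a module `M` over a Lie algebra: the
supremum, over all finite chains of submodules of `M`, of the number of successive quotients that
are isomorphic to `N`. By the Jordan-Hölder theorem this is the number of composition factors of
`M` isomorphic to `N` when `M` has finite length. -/
noncomputable def multiplicity (𝔩 M N : Type*) [LieRing 𝔩] [LieAlgebra ℂ 𝔩]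
    [AddCommGroup M] [Module ℂ M] [LieRingModule 𝔩 M] [LieModule ℂ 𝔩 M]
    [AddCommGroup N] [Module ℂ N] [LieRingModule 𝔩 N] [LieModule ℂ 𝔩 N] : ℕ∞ :=
  ⨆ (k : ℕ) (c : Fin (k + 1) →o LieSubmodule ℂ 𝔩 M),
    (Nat.card {i : Fin k // Nonempty
      ((↥(c i.succ) ⧸ (c i.castSucc).comap (c i.succ).incl) ≃ₗ⁅ℂ, 𝔩⁆ N)} : ℕ∞)

/-- The Gorelik-Grantcharov-Mazorchuk conjecture for the highest weight `λ`: if `λ ≠ 0` then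
`sch L(λ) = 0`. -/
def GGM (n : ℕ) (lam : Fin n → ℂ) : Prop :=
  lam ≠ 0 → ∀ H : Submodule ℂ (Fin n → ℂ), Maximal (IsIsotropic lam) H →
    HasFiniteWeightSpaces n (L n lam H) ∧ (LSuper n lam H).sch = 0

end Queer

namespace Queer

/-! ### Homogeneous elements, matrix units and the Casimir element of `gl(n)` -/

section Generators

variable {n : ℕ}

/-! Everything is proved for an arbitrary supermodule M generated by a vector of weight λ killed by
`n⁺` (`IsHighest`). Both `L(λ)` and the irreducible objects of `𝒪` are of this kind. The main tool
is the quadratic Casimir element C of `gl(n)`.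

Weight zero. M is spanned by words in the root vectors of `n⁻` applied to a finite-dimensional
`h`-stable space of singular vectors, and letters may be reordered modulo shorter words. Suppose a
word lands in weight 0. If it contains an even letter, that letter can be moved to the front. If all
its letters are odd and one repeats, two equal letters can be made adjacent, and their product is 0.
Otherwise its letters are distinct and odd, and λ is a sum of distinct positive roots. Excluding
this last case, the zero weight space is the sum of the f_α M_α, with f_α even
(`IsHighest.weightSpace_zero_le`).

Invertibility of C. On a singular vector of real weight μ with (μ, 2ρ) > 0, C acts by (μ, μ + 2ρ) >
0. Climbing to higher weights shows that C is injective on M_μ, hence bijective by finite dimension.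
In particular C is onto on each M_α. As C commutes with f_α, it is onto, hence bijective, on M_0
(`IsHighest.casimir_injective_zero`). A trivial `gl(n)`-subquotient would lie in weight 0 and be
killed by C, so there is none.

Supercharacter. For μ ≠ 0 some odd Cartan element is invertible on M_μ, so the two parities have
equal dimension. At every weight the supertrace of C^k vanishes for k ≥ 1: cyclicity of the trace
moves C^k E_ij E_ji between neighbouring weight spaces, and all correction terms vanish
(`strOn_casimir_pow_succ`). The minimal polynomial p of C on M_0 has p(0) ≠ 0, and 0 = str p(C) =
p(0) · sch(0), so the coefficient at 0 vanishes too.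

The exceptional weights are sums over subsets of a finite set of roots, hence finite in number. -/

theorem ev_add (A B : Gl n) : ev (A + B) = ev A + ev B := by simp [ev, ← map_add]

theorem od_add (A B : Gl n) : od (A + B) = od A + od B := by simp [od, ← map_add]

theorem ev_smul (c : ℂ) (A : Gl n) : ev (c • A) = c • ev A := by simp [ev, ← map_smul]

theorem od_smul (c : ℂ) (A : Gl n) : od (c • A) = c • od A := by simp [od, ← map_smul]

/-- The homogeneous elements of `q(n)`: odd ones for `b = true`, even ones for `b = false`. -/
noncomputable def gen (b : Bool) : Gl n →ₗ[ℂ] U n where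
  toFun A := if b then od A else ev A
  map_add' A B := by cases b <;> simp [ev_add, od_add]
  map_smul' c A := by cases b <;> simp [ev_smul, od_smul]

theorem gen_true (A : Gl n) : gen true A = od A := rfl

theorem gen_false (A : Gl n) : gen false A = ev A := rfl

/-- The sign by which homogeneous elements of parities `b` and `c` commute. -/
def sgn (b c : Bool) : ℂ := if b && c then -1 else 1

/-- One formula for all the supercommutation rules, so that the reordering arguments need no case
split on parity. -/
theorem gen_mul_gen (b c : Bool) (A B : Gl n) :
    gen b A * gen c B
      = sgn b c • (gen c B * gen b A) + gen (xor b c) (A * B - sgn b c • (B * A)) := by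
  cases b <;> cases c
  · simp [gen_false, sgn, ← ev_bracket]
  · simp [gen_false, gen_true, sgn, ← ev_od]
  · have h := ev_od B A
    have h2 : od (A * B - B * A) = - od (B * A - A * B) := by
      rw [← gen_true, ← gen_true, ← map_neg, neg_sub]
    simp [gen_false, gen_true, sgn, h2, ← h]
  · simp [gen_false, gen_true, sgn, ← od_od]

theorem gen_induction {N : Type*} [AddCommMonoid N] [Module ℂ N] (S : Submodule ℂ N)
    (f : Gl n →ₗ[ℂ] N) (h : ∀ i j, f (Matrix.single i j 1) ∈ S) (A : Gl n) : f A ∈ S := by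
  rw [Matrix.matrix_eq_sum_single A, map_sum]
  refine sum_mem fun i _ => ?_
  rw [map_sum]
  refine sum_mem fun j _ => ?_
  have : Matrix.single i j (A i j) = A i j • Matrix.single i j (1 : ℂ) := by simp
  rw [this, map_smul]
  exact S.smul_mem _ (h i j)

theorem diagonal_mul_single (h : Fin n → ℂ) (i j : Fin n) :
    Matrix.diagonal h * Matrix.single i j (1 : ℂ) = h i • Matrix.single i j (1 : ℂ) := by
  ext a b
  simp only [Matrix.diagonal_mul, Matrix.smul_apply, Matrix.single_apply, smul_eq_mul]
  split_ifs with hh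
  · rw [hh.1]
  · simp

theorem single_mul_diagonal (h : Fin n → ℂ) (i j : Fin n) :
    Matrix.single i j (1 : ℂ) * Matrix.diagonal h = h j • Matrix.single i j (1 : ℂ) := by
  ext a b
  simp only [Matrix.mul_diagonal, Matrix.smul_apply, Matrix.single_apply, smul_eq_mul]
  split_ifs with hh
  · rw [hh.2, mul_comm]
  · simp

theorem single_mul_single (i j k l : Fin n) :
    Matrix.single i j (1 : ℂ) * Matrix.single k l 1
      = if j = k then Matrix.single i l (1 : ℂ) else 0 := by
  split_ifs with h
  · subst h; simp
  · simp [Matrix.single_mul_single_of_ne, h]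

theorem ev_diagonal_mul_gen (b : Bool) (h : Fin n → ℂ) (i j : Fin n) :
    ev (Matrix.diagonal h) * gen b (Matrix.single i j 1)
      = gen b (Matrix.single i j 1) * ev (Matrix.diagonal h)
        + (h i - h j) • gen b (Matrix.single i j 1) := by
  have := gen_mul_gen false b (Matrix.diagonal h) (Matrix.single i j 1)
  rw [diagonal_mul_single, single_mul_diagonal] at this
  simp only [sgn, Bool.false_and, Bool.false_eq_true, if_false, one_smul, ← sub_smul,
    Bool.false_xor, map_smul] at this
  exact this

/-- The quadratic Casimir element of `gl(n)`. -/
noncomputable def casimir (n : ℕ) : U n :=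
  ∑ i, ∑ j, ev (Matrix.single i j 1) * ev (Matrix.single j i 1)

theorem ev_sub (A B : Gl n) : ev (A - B) = ev A - ev B := by simp [ev, ← map_sub]

theorem ev_zero : ev (0 : Gl n) = 0 := map_zero (gen false)

theorem ev_ite (p : Prop) [Decidable p] (A : Gl n) :
    ev (if p then A else 0) = if p then ev A else 0 := by
  split_ifs <;> simp [ev_zero]

theorem commute_casimir_single (k l : Fin n) :
    Commute (ev (Matrix.single k l 1)) (casimir n) := by
  -- The commutator with E_kl is a derivation. After summation the first of the four terms cancels
  -- the fourth and the second cancels the third.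
  have key : ∀ i j : Fin n,
      ev (Matrix.single k l 1) * (ev (Matrix.single i j 1) * ev (Matrix.single j i 1))
        - (ev (Matrix.single i j 1) * ev (Matrix.single j i 1)) * ev (Matrix.single k l 1)
      = ((if l = i then ev (Matrix.single k j 1) * ev (Matrix.single j i 1) else 0)
          - (if j = k then ev (Matrix.single i l 1) * ev (Matrix.single j i 1) else 0))
        + ((if l = j then ev (Matrix.single i j 1) * ev (Matrix.single k i 1) else 0)
          - (if i = k then ev (Matrix.single i j 1) * ev (Matrix.single j l (1 : ℂ)) else 0)) := by
    intro i j
    have h1 := ev_bracket (Matrix.single k l (1 : ℂ)) (Matrix.single i j 1)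
    have h2 := ev_bracket (Matrix.single k l (1 : ℂ)) (Matrix.single j i 1)
    rw [single_mul_single, single_mul_single, ev_sub, ev_ite, ev_ite] at h1 h2
    have : ev (Matrix.single k l 1) * (ev (Matrix.single i j 1) * ev (Matrix.single j i 1))
        - (ev (Matrix.single i j 1) * ev (Matrix.single j i 1)) * ev (Matrix.single k l 1)
      = (ev (Matrix.single k l 1) * ev (Matrix.single i j 1)
          - ev (Matrix.single i j 1) * ev (Matrix.single k l 1)) * ev (Matrix.single j i (1 : ℂ))
        + ev (Matrix.single i j 1) * (ev (Matrix.single k l 1) * ev (Matrix.single j i 1)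
          - ev (Matrix.single j i 1) * ev (Matrix.single k l 1)) := by noncomm_ring
    rw [this, h1, h2]
    simp only [sub_mul, mul_sub, ite_mul, mul_ite, zero_mul, mul_zero]
  rw [commute_iff_eq, ← sub_eq_zero, casimir, Finset.mul_sum, Finset.sum_mul,
    ← Finset.sum_sub_distrib]
  simp only [Finset.mul_sum, Finset.sum_mul, ← Finset.sum_sub_distrib, key]
  simp only [Finset.sum_add_distrib, Finset.sum_sub_distrib]
  have e1 : ∑ i : Fin n, ∑ j : Fin n, (if l = i then
      ev (Matrix.single k j 1) * ev (Matrix.single j i (1 : ℂ)) else 0)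
      = ∑ j, ev (Matrix.single k j 1) * ev (Matrix.single j l 1) := by
    rw [Finset.sum_comm]; simp
  have e2 : ∑ i : Fin n, ∑ j : Fin n, (if i = k then
      ev (Matrix.single i j 1) * ev (Matrix.single j l (1 : ℂ)) else 0)
      = ∑ j, ev (Matrix.single k j 1) * ev (Matrix.single j l 1) := by
    rw [Finset.sum_comm]; simp
  rw [e1, e2]
  simp

end Generators

/-! ### Weight spaces and projections onto them -/

section Action

variable {n : ℕ} {M : Type*} [AddCommGroup M] [Module ℂ M] [Module (U n) M]
  [IsScalarTower ℂ (U n) M]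

/-- The action of an element of `U(q(n))`, as a linear map. -/
noncomputable abbrev act (n : ℕ) (M : Type*) [AddCommGroup M] [Module ℂ M] [Module (U n) M]
    [IsScalarTower ℂ (U n) M] : U n →ₐ[ℂ] Module.End ℂ M := Algebra.lsmul ℂ ℂ M

theorem act_apply (u : U n) (x : M) : act n M u x = u • x := rfl

theorem gen_smul_mem {S : Submodule ℂ M} {b : Bool} {x : M}
    (h : ∀ i j : Fin n, gen b (Matrix.single i j (1 : ℂ)) • x ∈ S) (A : Gl n) : gen b A • x ∈ S :=
  gen_induction S (LinearMap.toSpanSingleton (U n) M x |>.restrictScalars ℂ |>.comp (gen b)) h A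

/-- A subspace that is stable under `q(n)` is stable under the enveloping algebra. -/
theorem smul_mem_of_gen {S : Submodule ℂ M}
    (h : ∀ b (A : Gl n), ∀ x ∈ S, gen b A • x ∈ S) (u : U n) {x : M} (hx : x ∈ S) :
    u • x ∈ S := by
  obtain ⟨t, rfl⟩ : ∃ t, mk n t = u := RingQuot.mkAlgHom_surjective ℂ (Rel n) u
  induction t using TensorAlgebra.induction generalizing x with
  | algebraMap r => rw [AlgHom.commutes, algebraMap_smul]; exact S.smul_mem r hx
  | ι y =>
    have e : mk n (TensorAlgebra.ι ℂ y) = gen false y.1 + gen true y.2 := by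
      change ι n y = ι n (y.1, 0) + ι n (0, y.2)
      rw [← map_add]; simp
    rw [e, add_smul]
    exact add_mem (h _ _ _ hx) (h _ _ _ hx)
  | mul a b ha hb => rw [map_mul, mul_smul]; exact ha (hb hx)
  | add a b ha hb => rw [map_add, add_smul]; exact add_mem (ha hx) (hb hx)

/-- The weight `δ_i - δ_j`. -/
noncomputable def root (i j : Fin n) : Fin n → ℂ := Pi.single i 1 - Pi.single j 1

theorem sum_mul_root (h : Fin n → ℂ) (i j : Fin n) : ∑ k, h k * root i j k = h i - h j := by
  simp [root, mul_sub, Finset.sum_sub_distrib, Pi.single_apply]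

theorem root_swap (i j : Fin n) : root i j = - root j i := by simp [root]

theorem gen_smul_mem_weightSpace (b : Bool) (i j : Fin n) {μ : Fin n → ℂ} {x : M}
    (hx : x ∈ weightSpace n M μ) :
    gen b (Matrix.single i j (1 : ℂ)) • x ∈ weightSpace n M (μ + root i j) := by
  intro h
  rw [← mul_smul, ev_diagonal_mul_gen, add_smul, mul_smul, hx h]
  simp only [Pi.add_apply, mul_add, Finset.sum_add_distrib, sum_mul_root, add_smul]
  rw [smul_comm, smul_assoc]

theorem ev_single_self_smul {μ : Fin n → ℂ} {x : M} (hx : x ∈ weightSpace n M μ) (i : Fin n) :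
    ev (Matrix.single i i (1 : ℂ)) • x = μ i • x := by
  have := hx (Pi.single i 1)
  rw [Matrix.diagonal_single] at this
  simpa [Pi.single_apply] using this

theorem casimir_smul_mem_weightSpace {μ : Fin n → ℂ} {x : M} (hx : x ∈ weightSpace n M μ) :
    casimir n • x ∈ weightSpace n M μ := by
  rw [casimir, Finset.sum_smul]
  refine sum_mem fun i _ => ?_
  rw [Finset.sum_smul]
  refine sum_mem fun j _ => ?_
  have h := gen_smul_mem_weightSpace false i j (gen_smul_mem_weightSpace false j i hx)
  rw [root_swap j i, neg_add_cancel_right] at h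
  rwa [mul_smul]

/-- An element of `U(h_0)` that acts as a projection to the weight space `M_μ` along finitely many
other weight spaces. -/
theorem exists_weight_projector (μ : Fin n → ℂ) (F : Finset (Fin n → ℂ)) :
    ∃ u : U n, (∀ ν ∈ F, ν ≠ μ → ∀ x ∈ weightSpace n M ν, u • x = 0) ∧
      ∀ N : Submodule ℂ M, (∀ h : Fin n → ℂ, ∀ x ∈ N, ev (Matrix.diagonal h) • x ∈ N) →
        (∀ x ∈ N, u • x ∈ N) ∧
        ∀ x, (∀ h : Fin n → ℂ, ev (Matrix.diagonal h) • x - (∑ i, h i * μ i) • x ∈ N) → u • x - x ∈ N := by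
  induction F using Finset.induction with
  | empty => exact ⟨1, by simp, by simp⟩
  | insert ν F _ ih =>
    obtain ⟨u, hu, hN⟩ := ih
    by_cases hνμ : ν = μ
    · refine ⟨u, fun ν' hν' hne => ?_, hN⟩
      rcases Finset.mem_insert.mp hν' with rfl | h
      · exact absurd hνμ hne
      · exact hu ν' h hne
    obtain ⟨i, hi⟩ := Function.ne_iff.mp hνμ
    have hi' : μ i - ν i ≠ 0 := sub_ne_zero.mpr (Ne.symm hi)
    -- A linear factor that is 0 on weight ν and normalised to be 1 on weight μ, using a coordinate
    -- where the two differ.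
    set t : U n := (μ i - ν i)⁻¹ • (ev (Matrix.single i i 1) - algebraMap ℂ _ (ν i)) with ht
    have htx : ∀ x : M, t • x
        = (μ i - ν i)⁻¹ • (ev (Matrix.single i i (1 : ℂ)) • x - ν i • x) := fun x => by
      rw [ht, smul_assoc, sub_smul, algebraMap_smul]
    refine ⟨u * t, fun ν' hν' hne x hx => ?_, fun N hs => ?_⟩
    · rw [mul_smul, htx, ev_single_self_smul hx]
      rcases Finset.mem_insert.mp hν' with rfl | h
      · simp
      · exact hu _ h hne _ (Submodule.smul_mem _ _
          (sub_mem (Submodule.smul_mem _ _ hx) (Submodule.smul_mem _ _ hx)))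
    · obtain ⟨h1, h2⟩ := hN N hs
      have hs' : ∀ x ∈ N, ev (Matrix.single i i (1 : ℂ)) • x ∈ N := fun x hx => by
        rw [← Matrix.diagonal_single]; exact hs _ x hx
      have h3 : ∀ x ∈ N, t • x ∈ N := fun x hx => by
        rw [htx]
        exact N.smul_mem _ (sub_mem (hs' x hx) (N.smul_mem _ hx))
      refine ⟨fun x hx => by rw [mul_smul]; exact h1 _ (h3 x hx), fun x hx => ?_⟩
      have h4 : t • x - x ∈ N := by
        have h5 : t • x - x = (μ i - ν i)⁻¹ • (ev (Matrix.single i i (1 : ℂ)) • x - μ i • x) := by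
          have h6 : x = (μ i - ν i)⁻¹ • (μ i - ν i) • x := by
            rw [smul_smul, inv_mul_cancel₀ hi', one_smul]
          rw [htx]
          nth_rewrite 3 [h6]
          rw [← smul_sub, sub_smul]
          congr 1
          abel
        rw [h5]
        refine N.smul_mem _ ?_
        have := hx (Pi.single i 1)
        rw [Matrix.diagonal_single] at this
        simpa [Pi.single_apply] using this
      have := add_mem (h1 _ h4) (h2 x hx)
      rwa [smul_sub, sub_add_sub_cancel, ← mul_smul] at this

theorem projector_smul_mem {μ : Fin n → ℂ} {u : U n} {F : Finset (Fin n → ℂ)}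
    (hu : ∀ ν ∈ F, ν ≠ μ → ∀ x ∈ weightSpace n M ν, u • x = 0)
    (hu' : ∀ x ∈ weightSpace n M μ, u • x = x) {x : M}
    (hx : x ∈ ⨆ ν ∈ F, weightSpace n M ν) : u • x ∈ weightSpace n M μ := by
  have : (⨆ ν ∈ F, weightSpace n M ν) ≤ (weightSpace n M μ).comap (act n M u) := by
    refine iSup₂_le fun ν hν y hy => ?_
    change (u • y : M) ∈ weightSpace n M μ
    by_cases h : ν = μ
    · subst h; rwa [hu' y hy]
    · rw [hu ν hν h y hy]; exact zero_mem _
  exact this hx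

theorem projector_smul_eq {μ : Fin n → ℂ} {u : U n}
    (hN : ∀ N : Submodule ℂ M, (∀ h : Fin n → ℂ, ∀ x ∈ N, ev (Matrix.diagonal h) • x ∈ N) →
        (∀ x ∈ N, u • x ∈ N) ∧
        ∀ x, (∀ h : Fin n → ℂ, ev (Matrix.diagonal h) • x - (∑ i, h i * μ i) • x ∈ N) → u • x - x ∈ N)
    {x : M} (hx : x ∈ weightSpace n M μ) : u • x = x := by
  have := (hN ⊥ (by simp)).2 x (fun h => by rw [hx h]; simp)
  exact sub_eq_zero.mp (by simpa using this)

/-- A sum of other weight spaces involves only finitely many of them at a time, and a projector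
fixes the weight space of μ while killing those. -/
theorem weightSpace_disjoint (μ : Fin n → ℂ) :
    Disjoint (weightSpace n M μ) (⨆ ν ≠ μ, weightSpace n M ν) := by
  rw [Submodule.disjoint_def]
  intro x hx hx'
  rw [iSup_subtype' (p := fun ν => ν ≠ μ), Submodule.mem_iSup_iff_exists_finset] at hx'
  obtain ⟨F, hF⟩ := hx'
  obtain ⟨u, hu, hN⟩ := exists_weight_projector (M := M) μ (F.map (Function.Embedding.subtype _))
  rw [← projector_smul_eq hN hx]
  have : (⨆ ν ∈ F, weightSpace n M ν.1) ≤ LinearMap.ker (act n M u) := by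
    refine iSup₂_le fun ν hν y hy => ?_
    exact hu ν.1 (by simpa using ⟨ν.2, hν⟩) ν.2 y hy
  exact this hF

/-- If `x` is a weight vector modulo a stable subspace `N`, then it agrees modulo `N` with a
weight vector. -/
theorem exists_weight_vector_sub_mem (hM : ⨆ ν, weightSpace n M ν = ⊤) (μ : Fin n → ℂ)
    (N : Submodule ℂ M) (hs : ∀ h : Fin n → ℂ, ∀ x ∈ N, ev (Matrix.diagonal h) • x ∈ N) (x : M)
    (hx : ∀ h : Fin n → ℂ, ev (Matrix.diagonal h) • x - (∑ i, h i * μ i) • x ∈ N) :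
    ∃ y ∈ weightSpace n M μ, y - x ∈ N := by
  have hx' : x ∈ ⨆ ν, weightSpace n M ν := hM ▸ Submodule.mem_top
  rw [Submodule.mem_iSup_iff_exists_finset] at hx'
  obtain ⟨F, hF⟩ := hx'
  obtain ⟨u, hu, hN⟩ := exists_weight_projector (M := M) μ F
  exact ⟨u • x, projector_smul_mem hu (fun y hy => projector_smul_eq hN hy) hF, (hN N hs).2 x hx⟩

end Action

/-! ### Words in the negative root vectors: the spanning half of the PBW theorem -/

section Words

set_option linter.unusedSectionVars false

variable {n : ℕ} {M : Type*} [AddCommGroup M] [Module ℂ M] [Module (U n) M]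
  [IsScalarTower ℂ (U n) M]

/-- Half of the bracket of an odd element with itself. A Cartan element thus has an odd square root,
which is what makes the two parities balance at nonzero weights. -/
theorem od_single_self_mul (i : Fin n) :
    od (Matrix.single i i 1) * od (Matrix.single i i 1) = ev (Matrix.single i i (1 : ℂ)) := by
  have h := od_od (Matrix.single i i (1 : ℂ)) (Matrix.single i i 1)
  rw [single_mul_single, if_pos rfl, ev_add, ← two_smul ℂ, ← two_smul ℂ] at h
  exact smul_right_injective _ (two_ne_zero (α := ℂ)) h

variable (n M) in
/-- The vectors of weight `lam` that are killed by `n⁺`. -/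
noncomputable def singularSpace (lam : Fin n → ℂ) : Submodule ℂ M :=
  weightSpace n M lam ⊓
    ⨅ (b : Bool) (i : Fin n) (j : Fin n) (_ : i < j),
      LinearMap.ker (act n M (gen b (Matrix.single i j 1)))

theorem mem_singularSpace {lam : Fin n → ℂ} {x : M} :
    x ∈ singularSpace n M lam ↔ x ∈ weightSpace n M lam ∧
      ∀ (b : Bool) (i j : Fin n), i < j → gen b (Matrix.single i j (1 : ℂ)) • x = 0 := by
  simp [singularSpace]

/-- The odd Cartan elements commute with `h_0` and normalise `n⁺`. -/
theorem od_single_smul_mem_singularSpace {lam : Fin n → ℂ} {x : M}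
    (hx : x ∈ singularSpace n M lam) (i : Fin n) :
    od (Matrix.single i i (1 : ℂ)) • x ∈ singularSpace n M lam := by
  rw [mem_singularSpace] at hx ⊢
  refine ⟨?_, fun b k l hkl => ?_⟩
  · have := gen_smul_mem_weightSpace true i i hx.1
    rwa [show root i i = 0 by simp [root], add_zero] at this
  · rw [← gen_true, ← mul_smul, gen_mul_gen, add_smul, smul_assoc, mul_smul, hx.2 b k l hkl,
      smul_zero, smul_zero, zero_add, single_mul_single, single_mul_single, map_sub, map_smul,
      sub_smul, smul_assoc]
    have h0 : ∀ c : Bool, gen c (Matrix.single k l (1 : ℂ)) • x = 0 := fun c => hx.2 c k l hkl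
    have h1 : gen (xor b true) (if l = i then Matrix.single k i (1 : ℂ) else 0) • x = 0 := by
      split_ifs with h
      · rw [← h]; exact h0 _
      · simp
    have h2 : gen (xor b true) (if i = k then Matrix.single i l (1 : ℂ) else 0) • x = 0 := by
      split_ifs with h
      · rw [h]; exact h0 _
      · simp
    rw [h1, h2, smul_zero, sub_zero]

/-- The `h`-module generated by a singular vector is finite-dimensional. -/
theorem exists_stable_singular {lam : Fin n → ℂ} {v : M} (hv : v ∈ singularSpace n M lam)
    (s : Finset (Fin n)) :
    ∃ X : Submodule ℂ M, FiniteDimensional ℂ X ∧ v ∈ X ∧ X ≤ singularSpace n M lam ∧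
      ∀ i ∈ s, ∀ x ∈ X, od (Matrix.single i i (1 : ℂ)) • x ∈ X := by
  induction s using Finset.induction with
  | empty =>
    exact ⟨ℂ ∙ v, inferInstance, Submodule.mem_span_singleton_self v,
      (Submodule.span_singleton_le_iff_mem _ _).mpr hv, by simp⟩
  | insert i s _ ih =>
    obtain ⟨X, hfd, hvX, hX, hs⟩ := ih
    refine ⟨X ⊔ X.map (act n M (od (Matrix.single i i 1))), inferInstance,
      Submodule.mem_sup_left hvX, sup_le hX ?_, fun j hj x hx => ?_⟩
    · rintro _ ⟨x, hx, rfl⟩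
      exact od_single_smul_mem_singularSpace (hX hx) i
    · obtain ⟨y, hy, _, ⟨z, hz, rfl⟩, rfl⟩ := Submodule.mem_sup.mp hx
      have hw := (mem_singularSpace.mp (hX hz)).1
      rw [smul_add, act_apply]
      rcases Finset.mem_insert.mp hj with rfl | hj
      · refine add_mem (Submodule.mem_sup_right ⟨y, hy, rfl⟩) (Submodule.mem_sup_left ?_)
        rw [← mul_smul, od_single_self_mul, ev_single_self_smul hw]
        exact X.smul_mem _ hz
      · refine add_mem (Submodule.mem_sup_left (hs j hj y hy)) ?_
        -- Anticommuting two odd Cartan elements costs only an element of `h_0`, which is a scalar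
        -- on singular vectors.
        have h := od_od (Matrix.single j j (1 : ℂ)) (Matrix.single i i 1)
        rw [← mul_smul, eq_sub_of_add_eq h, sub_smul]
        refine sub_mem (Submodule.mem_sup_left ?_) (Submodule.mem_sup_right ?_)
        · rw [← Matrix.diagonal_single, ← Matrix.diagonal_single, Matrix.diagonal_mul_diagonal,
            Matrix.diagonal_mul_diagonal, Matrix.diagonal_add, hw]
          exact X.smul_mem _ hz
        · rw [mul_smul]
          exact ⟨_, hs j hj z hz, rfl⟩

/-- The root vectors of `n⁻`: a parity and a position below the diagonal. -/
abbrev Letter (n : ℕ) : Type := {p : Bool × Fin n × Fin n // p.2.2 < p.2.1}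

/-- The root vector in `U(q(n))` named by a letter. -/
noncomputable def Letter.toU (a : Letter n) : U n :=
  gen a.1.1 (Matrix.single a.1.2.1 a.1.2.2 1)

/-- The negative root named by a letter. -/
noncomputable def Letter.wt (a : Letter n) : Fin n → ℂ := root a.1.2.1 a.1.2.2

/-- The product of the root vectors in a word. -/
noncomputable def wordProd (w : List (Letter n)) : U n := (w.map Letter.toU).prod

/-- The weight of a word. -/
noncomputable def wordWt (w : List (Letter n)) : Fin n → ℂ := (w.map Letter.wt).sum

theorem wordProd_cons (a : Letter n) (w : List (Letter n)) :
    wordProd (a :: w) = a.toU * wordProd w := by simp [wordProd]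

theorem wordWt_cons (a : Letter n) (w : List (Letter n)) :
    wordWt (a :: w) = a.wt + wordWt w := by simp [wordWt]

theorem wordProd_smul_mem_weightSpace {lam : Fin n → ℂ} {x : M} (hx : x ∈ weightSpace n M lam)
    (w : List (Letter n)) : wordProd w • x ∈ weightSpace n M (lam + wordWt w) := by
  induction w with
  | nil => simpa [wordProd, wordWt] using hx
  | cons a w ih =>
    rw [wordProd_cons, wordWt_cons, mul_smul, add_comm a.wt, ← add_assoc]
    exact gen_smul_mem_weightSpace _ _ _ ih

/-- The span of the words of length less than `k`, applied to `X`. -/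
noncomputable def wordSpan (X : Submodule ℂ M) (k : ℕ) : Submodule ℂ M :=
  Submodule.span ℂ {y | ∃ w : List (Letter n), w.length < k ∧ ∃ x ∈ X, y = wordProd w • x}

theorem wordProd_smul_mem_wordSpan {X : Submodule ℂ M} {k : ℕ} {w : List (Letter n)}
    (hw : w.length < k) {x : M} (hx : x ∈ X) : wordProd w • x ∈ wordSpan (n := n) X k :=
  Submodule.subset_span ⟨w, hw, x, hx, rfl⟩

theorem wordSpan_mono {X : Submodule ℂ M} {k l : ℕ} (h : k ≤ l) :
    wordSpan (n := n) X k ≤ wordSpan (n := n) X l :=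
  Submodule.span_mono fun _ ⟨w, hw, hx⟩ => ⟨w, hw.trans_le h, hx⟩

theorem smul_mem_of_mem_wordSpan {X : Submodule ℂ M} {k : ℕ} {S : Submodule ℂ M} {u : U n}
    (h : ∀ w : List (Letter n), w.length < k → ∀ x ∈ X, u • wordProd w • x ∈ S) {y : M}
    (hy : y ∈ wordSpan (n := n) X k) : u • y ∈ S := by
  have : wordSpan (n := n) X k ≤ S.comap (act n M u) := by
    refine Submodule.span_le.mpr ?_
    rintro _ ⟨w, hw, x, hx, rfl⟩
    exact h w hw x hx
  exact this hy

theorem letter_smul_mem_wordSpan {X : Submodule ℂ M} {k : ℕ} (a : Letter n) {y : M}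
    (hy : y ∈ wordSpan (n := n) X k) : a.toU • y ∈ wordSpan (n := n) X (k + 1) := by
  refine smul_mem_of_mem_wordSpan (fun w hw x hx => ?_) hy
  rw [← mul_smul, ← wordProd_cons]
  exact wordProd_smul_mem_wordSpan (by simpa using hw) hx

variable {lam : Fin n → ℂ} {X : Submodule ℂ M}

/-- Elements of `b` do not increase the length of words. -/
theorem gen_smul_word_mem (hX : X ≤ singularSpace n M lam)
    (hod : ∀ i : Fin n, ∀ x ∈ X, od (Matrix.single i i (1 : ℂ)) • x ∈ X) (w : List (Letter n)) :
    (∀ b (i j : Fin n), i ≤ j → ∀ x ∈ X,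
      gen b (Matrix.single i j (1 : ℂ)) • wordProd w • x ∈ wordSpan (n := n) X (w.length + 1)) ∧
    ∀ b (A : Gl n), ∀ x ∈ X,
      gen b A • wordProd w • x ∈ wordSpan (n := n) X (w.length + 2) := by
  -- For a fixed word the second bound follows from the first: a root vector of `n⁻` is just one
  -- more letter. So only the first needs induction.
  have key : ∀ w : List (Letter n), (∀ b (i j : Fin n), i ≤ j → ∀ x ∈ X,
      gen b (Matrix.single i j (1 : ℂ)) • wordProd w • x ∈ wordSpan (n := n) X (w.length + 1)) →
      ∀ b (A : Gl n), ∀ x ∈ X,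
        gen b A • wordProd w • x ∈ wordSpan (n := n) X (w.length + 2) := by
    intro w hw b A x hx
    refine gen_smul_mem (fun i j => ?_) A
    rcases le_or_gt i j with h | h
    · exact wordSpan_mono (by omega) (hw b i j h x hx)
    · exact letter_smul_mem_wordSpan ⟨(b, i, j), h⟩ (wordProd_smul_mem_wordSpan (by omega) hx)
  suffices h : ∀ b (i j : Fin n), i ≤ j → ∀ x ∈ X,
      gen b (Matrix.single i j (1 : ℂ)) • wordProd w • x ∈ wordSpan (n := n) X (w.length + 1) from
    ⟨h, key w h⟩
  induction w with
  | nil =>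
    intro b i j hij x hx
    have hx' := mem_singularSpace.mp (hX hx)
    have h1 : ∀ y ∈ X, y ∈ wordSpan (n := n) X 1 := fun y hy => by
      simpa [wordProd] using wordProd_smul_mem_wordSpan (w := []) (k := 1) (by simp) hy
    simp only [wordProd, List.map_nil, List.prod_nil, one_smul, List.length_nil, zero_add]
    rcases hij.lt_or_eq with h | rfl
    · rw [hx'.2 b i j h]; exact zero_mem _
    · cases b
      · rw [gen_false, ev_single_self_smul hx'.1]
        exact h1 _ (X.smul_mem _ hx)
      · exact h1 _ (hod i x hx)
  | cons a w ih =>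
    intro b i j hij x hx
    rw [wordProd_cons, mul_smul, Letter.toU, ← mul_smul, gen_mul_gen, add_smul, smul_assoc,
      mul_smul]
    -- The commutator with the first letter can be any element of q(n), but it acts on a word
    -- shorter by one, so `key` suffices.
    refine add_mem (Submodule.smul_mem _ _ ?_) (key w ih _ _ x hx)
    exact letter_smul_mem_wordSpan a (ih b i j hij x hx)

/-- The union of the length filtration contains the generator and is stable under q(n), because each
element of q(n) raises the filtration degree by at most one. -/
theorem iSup_wordSpan_eq_top {v : M} (hX : X ≤ singularSpace n M lam)
    (hod : ∀ i : Fin n, ∀ x ∈ X, od (Matrix.single i i (1 : ℂ)) • x ∈ X) (hv : v ∈ X)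
    (htop : Submodule.span (U n) {v} = ⊤) : ⨆ k, wordSpan (n := n) X k = ⊤ := by
  have hmono : Monotone (wordSpan (n := n) X) := fun _ _ h => wordSpan_mono h
  have hgen : ∀ b (A : Gl n), ∀ x ∈ ⨆ k, wordSpan (n := n) X k,
      gen b A • x ∈ ⨆ k, wordSpan (n := n) X k := by
    intro b A x hx
    obtain ⟨k, hk⟩ := (Submodule.mem_iSup_of_directed _ hmono.directed_le).mp hx
    refine Submodule.mem_iSup_of_mem (k + 1) (smul_mem_of_mem_wordSpan (fun w hw x hx => ?_) hk)
    exact wordSpan_mono (by omega) ((gen_smul_word_mem hX hod w).2 b A x hx)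
  have hvm : v ∈ ⨆ k, wordSpan (n := n) X k :=
    Submodule.mem_iSup_of_mem 1 (by
      simpa [wordProd] using wordProd_smul_mem_wordSpan (w := []) (k := 1) (by simp) hv)
  refine Submodule.eq_top_iff'.mpr fun y => ?_
  obtain ⟨u, rfl⟩ := Submodule.mem_span_singleton.mp (htop ▸ Submodule.mem_top : y ∈ _)
  exact smul_mem_of_gen hgen u hvm

/-- Induction on word length in which all strictly shorter words are already known to lie in `S`, so
that reordering errors can be discarded. -/
theorem wordProd_smul_induction {v : M} (hX : X ≤ singularSpace n M lam)
    (hod : ∀ i : Fin n, ∀ x ∈ X, od (Matrix.single i i (1 : ℂ)) • x ∈ X) (hv : v ∈ X)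
    (htop : Submodule.span (U n) {v} = ⊤) (S : Submodule ℂ M)
    (h : ∀ w : List (Letter n), wordSpan (n := n) X w.length ≤ S → ∀ x ∈ X, wordProd w • x ∈ S) :
    S = ⊤ := by
  rw [eq_top_iff, ← iSup_wordSpan_eq_top hX hod hv htop]
  refine iSup_le fun k => ?_
  induction k with
  | zero => exact Submodule.span_le.mpr fun _ ⟨w, hw, _⟩ => absurd hw (by omega)
  | succ k ih =>
    refine Submodule.span_le.mpr ?_
    rintro _ ⟨w, hw, x, hx, rfl⟩
    exact h w ((wordSpan_mono (by omega)).trans ih) x hx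

/-- Reordering a word changes it by a scalar, up to shorter words. -/
theorem exists_wordProd_perm (hX : X ≤ singularSpace n M lam)
    (hod : ∀ i : Fin n, ∀ x ∈ X, od (Matrix.single i i (1 : ℂ)) • x ∈ X) {w w' : List (Letter n)}
    (h : w.Perm w') : ∃ s : ℂ, ∀ x ∈ X,
      wordProd w • x - s • wordProd w' • x ∈ wordSpan (n := n) X w.length := by
  induction h with
  | nil => exact ⟨1, by simp⟩
  | cons a h ih =>
    obtain ⟨s, hs⟩ := ih
    refine ⟨s, fun x hx => ?_⟩
    have := letter_smul_mem_wordSpan a (hs x hx)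
    rwa [smul_sub, smul_comm a.toU s, ← mul_smul, ← mul_smul, ← wordProd_cons, ← wordProd_cons] at this
  | swap a b w =>
    -- Swapping two adjacent letters gives the super sign, and the bracket replaces two letters by
    -- one element, which shortens the word.
    refine ⟨sgn b.1.1 a.1.1, fun x hx => ?_⟩
    have e := gen_mul_gen b.1.1 a.1.1 (Matrix.single b.1.2.1 b.1.2.2 1)
      (Matrix.single a.1.2.1 a.1.2.2 1)
    rw [← sub_eq_iff_eq_add'] at e
    have h2 := (gen_smul_word_mem hX hod w).2 (xor b.1.1 a.1.1)
      (Matrix.single b.1.2.1 b.1.2.2 1 * Matrix.single a.1.2.1 a.1.2.2 1 -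
        sgn b.1.1 a.1.1 • (Matrix.single a.1.2.1 a.1.2.2 1 * Matrix.single b.1.2.1 b.1.2.2 1)) x hx
    rw [← e, sub_smul, smul_assoc] at h2
    simpa only [wordProd_cons, mul_smul] using! h2
  | trans h1 _ ih1 ih2 =>
    obtain ⟨s, hs⟩ := ih1
    obtain ⟨t, ht⟩ := ih2
    refine ⟨s * t, fun x hx => ?_⟩
    have := add_mem (hs x hx) (Submodule.smul_mem _ s (h1.length_eq ▸ ht x hx))
    rwa [smul_sub, sub_add_sub_cancel, ← mul_smul] at this

end Words

/-! ### Highest weight modules and their zero weight space -/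

section HighestWeight

set_option linter.unusedSectionVars false

variable {n : ℕ} {M : Type*} [AddCommGroup M] [Module ℂ M] [Module (U n) M]
  [IsScalarTower ℂ (U n) M]

/-- The real part of the pairing of a weight with the sum of the positive roots of `gl(n)`. -/
noncomputable def height (μ : Fin n → ℂ) : ℝ := ∑ i : Fin n, ((n : ℝ) - 1 - 2 * i) * (μ i).re

theorem height_add (μ ν : Fin n → ℂ) : height (μ + ν) = height μ + height ν := by
  simp [height, mul_add, Finset.sum_add_distrib]

theorem height_root (i j : Fin n) : height (root i j) = 2 * ((j : ℝ) - i) := by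
  have : ∀ k l : Fin n, ((Pi.single k 1 : Fin n → ℂ) l).re = if l = k then 1 else 0 := by
    intro k l
    rw [Pi.single_apply]
    split_ifs <;> simp
  simp [height, root, mul_sub, Finset.sum_sub_distrib, this]

/-- Each raising step gains a definite amount of height, so every climbing argument ends after
finitely many steps. -/
theorem height_root_of_lt {i j : Fin n} (h : i < j) : 1 ≤ height (root i j) := by
  rw [height_root]
  have : ((i : ℕ) : ℝ) + 1 ≤ (j : ℕ) := by exact_mod_cast h
  linarith

theorem height_wordWt (w : List (Letter n)) : height (wordWt w) ≤ -w.length := by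
  induction w with
  | nil => simp [wordWt, height]
  | cons a w ih =>
    have h : height a.wt ≤ -1 := by
      have h1 := height_root_of_lt a.2
      rw [height_root] at h1
      rw [Letter.wt, height_root]
      linarith
    rw [wordWt_cons, height_add, List.length_cons]
    push_cast
    linarith

/-- `v` is a highest weight vector of weight `lam` that generates the module. -/
structure IsHighest (lam : Fin n → ℂ) (v : M) : Prop where
  mem : v ∈ singularSpace n M lam
  span_eq_top : Submodule.span (U n) {v} = ⊤

theorem finiteDimensional_wordSpan (X : Submodule ℂ M) [FiniteDimensional ℂ X] (k : ℕ) :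
    FiniteDimensional ℂ (wordSpan (n := n) X k) := by
  have : Finite {w : List (Letter n) // w.length < k} := (List.finite_length_lt (Letter n) k)
  have h : wordSpan (n := n) X k ≤
      ⨆ w : {w : List (Letter n) // w.length < k}, X.map (act n M (wordProd w.1)) := by
    refine Submodule.span_le.mpr ?_
    rintro _ ⟨w, hw, x, hx, rfl⟩
    exact Submodule.mem_iSup_of_mem ⟨w, hw⟩ ⟨x, hx, rfl⟩
  exact Submodule.finiteDimensional_of_le h

namespace IsHighest

variable {lam : Fin n → ℂ} {v : M}

theorem word_induction (hv : IsHighest lam v) :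
    ∃ X : Submodule ℂ M, FiniteDimensional ℂ X ∧ X ≤ singularSpace n M lam ∧
      (∀ i : Fin n, ∀ x ∈ X, od (Matrix.single i i (1 : ℂ)) • x ∈ X) ∧
      ∀ S : Submodule ℂ M, (∀ w : List (Letter n), wordSpan (n := n) X w.length ≤ S →
        ∀ x ∈ X, wordProd w • x ∈ S) → S = ⊤ := by
  obtain ⟨X, hfd, hvX, hX, hs⟩ := exists_stable_singular hv.mem Finset.univ
  exact ⟨X, hfd, hX, fun i => hs i (Finset.mem_univ i), fun S hS =>
    wordProd_smul_induction hX (fun i => hs i (Finset.mem_univ i)) hvX hv.span_eq_top S hS⟩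

theorem iSup_weightSpace (hv : IsHighest lam v) : ⨆ μ, weightSpace n M μ = ⊤ := by
  obtain ⟨X, _, hX, _, hS⟩ := hv.word_induction
  refine hS _ fun w _ x hx => ?_
  exact Submodule.mem_iSup_of_mem _
    (wordProd_smul_mem_weightSpace (mem_singularSpace.mp (hX hx)).1 w)

/-- Words never raise the height, so the weight spaces other than that of `μ` already span the
module. -/
theorem weightSpace_eq_bot (hv : IsHighest lam v) {μ : Fin n → ℂ} (h : height lam < height μ) :
    weightSpace n M μ = ⊥ := by
  obtain ⟨X, _, hX, _, hS⟩ := hv.word_induction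
  have htop : (⨆ ν ≠ μ, weightSpace n M ν) = ⊤ := by
    refine hS _ fun w _ x hx => ?_
    refine Submodule.mem_iSup_of_mem (lam + wordWt w) (Submodule.mem_iSup_of_mem ?_
      (wordProd_smul_mem_weightSpace (mem_singularSpace.mp (hX hx)).1 w))
    rintro rfl
    rw [height_add] at h
    have := height_wordWt w
    have : (0 : ℝ) ≤ w.length := Nat.cast_nonneg _
    linarith
  have := weightSpace_disjoint (M := M) μ
  rwa [htop, disjoint_top] at this

theorem hasFiniteWeightSpaces (hv : IsHighest lam v) : HasFiniteWeightSpaces n M := by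
  intro μ
  obtain ⟨X, _, hX, _, hS⟩ := hv.word_induction
  -- Each letter lowers the height by at least 1, so only words shorter than `N` can reach the
  -- weight `μ`.
  obtain ⟨N, hN⟩ := exists_nat_gt (height lam - height μ)
  have := finiteDimensional_wordSpan (n := n) X N
  have htop : (wordSpan (n := n) X N ⊓ weightSpace n M μ) ⊔ (⨆ ν ≠ μ, weightSpace n M ν) = ⊤ := by
    refine hS _ fun w _ x hx => ?_
    have hw := wordProd_smul_mem_weightSpace (mem_singularSpace.mp (hX hx)).1 w
    by_cases hμ : lam + wordWt w = μ
    · subst hμ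
      refine Submodule.mem_sup_left ⟨wordProd_smul_mem_wordSpan ?_ hx, hw⟩
      rw [height_add] at hN
      have := height_wordWt w
      have : (w.length : ℝ) < N := by linarith
      exact_mod_cast this
    · exact Submodule.mem_sup_right
        (Submodule.mem_iSup_of_mem _ (Submodule.mem_iSup_of_mem hμ hw))
  have hle : weightSpace n M μ ≤ wordSpan (n := n) X N := by
    intro x hx
    obtain ⟨y, hy, z, hz, rfl⟩ := Submodule.mem_sup.mp (htop ▸ Submodule.mem_top : x ∈ _)
    have hz' : z ∈ weightSpace n M μ := by simpa using sub_mem hx hy.2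
    rw [(Submodule.disjoint_def.mp (weightSpace_disjoint μ)) z hz' hz, add_zero]
    exact hy.1
  exact Submodule.finiteDimensional_of_le hle

end IsHighest

theorem root_injective {i j k l : Fin n} (hij : i ≠ j) (h : root i j = root k l) :
    i = k ∧ j = l := by
  have hi := congrFun h i
  have hj := congrFun h j
  simp only [root, Pi.sub_apply, Pi.single_apply, if_pos, if_neg hij, if_neg hij.symm] at hi hj
  constructor
  · by_contra hik
    rw [if_neg hik] at hi
    split_ifs at hi <;> norm_num at hi
  · by_contra hjl
    rw [if_neg hjl] at hj
    split_ifs at hj <;> norm_num at hj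

/-- The weight of a product of distinct odd negative root vectors is minus the sum of a set of
positive roots. -/
theorem exists_posRoots_sum {w : List (Letter n)} (hodd : ∀ a ∈ w, a.1.1 = true)
    (hw : w.Nodup) :
    ∃ I : Finset (Fin n → ℂ), (I : Set (Fin n → ℂ)) ⊆ posRoots n ∧ - wordWt w = ∑ α ∈ I, α := by
  classical
  have hnd : (w.map (fun a => root a.1.2.2 a.1.2.1)).Nodup := by
    refine hw.map_on fun a ha b hb hab => ?_
    obtain ⟨h1, h2⟩ := root_injective a.2.ne hab
    exact Subtype.ext (Prod.ext ((hodd a ha).trans (hodd b hb).symm) (Prod.ext h2 h1))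
  refine ⟨(w.map (fun a => root a.1.2.2 a.1.2.1)).toFinset, fun α hα => ?_, ?_⟩
  · simp only [List.coe_toFinset, Set.mem_ofPred_eq, List.mem_map] at hα
    obtain ⟨a, _, rfl⟩ := hα
    exact ⟨_, _, a.2, rfl⟩
  · rw [List.sum_toFinset _ hnd, List.map_id']
    clear hnd hw hodd
    induction w with
    | nil => simp [wordWt]
    | cons a w ih =>
      rw [wordWt_cons, neg_add, ih, List.map_cons, List.sum_cons, Letter.wt, ← root_swap]

/-- An off-diagonal matrix unit squares to zero, so the bracket of an odd root vector with itself,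
twice its square, vanishes. -/
theorem toU_mul_self {a : Letter n} (h : a.1.1 = true) : a.toU * a.toU = 0 := by
  have h1 := od_od (Matrix.single a.1.2.1 a.1.2.2 (1 : ℂ)) (Matrix.single a.1.2.1 a.1.2.2 1)
  rw [single_mul_single, if_neg a.2.ne, add_zero, ev_zero, ← two_smul ℂ] at h1
  rw [Letter.toU, h, gen_true]
  exact (smul_eq_zero.mp h1).resolve_left two_ne_zero

/-- If `lam` is not a sum of distinct positive roots, then the weight space of weight zero is
spanned by the images of the negative root vectors of `gl(n)`. -/
theorem IsHighest.weightSpace_zero_le {lam : Fin n → ℂ} {v : M} (hv : IsHighest lam v)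
    (hlam : ∀ I : Finset (Fin n → ℂ), (I : Set (Fin n → ℂ)) ⊆ posRoots n → lam ≠ ∑ α ∈ I, α) :
    weightSpace n M 0 ≤ ⨆ (i : Fin n) (j : Fin n) (_ : i < j),
      (weightSpace n M (root i j)).map (act n M (ev (Matrix.single j i 1))) := by
  obtain ⟨X, _, hX, hod, hS⟩ := hv.word_induction
  set Y : Submodule ℂ M := ⨆ (i : Fin n) (j : Fin n) (_ : i < j),
      (weightSpace n M (root i j)).map (act n M (ev (Matrix.single j i 1))) with hY
  have hY0 : Y ≤ weightSpace n M 0 := by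
    refine iSup_le fun i => iSup_le fun j => iSup_le fun _ => ?_
    rintro _ ⟨x, hx, rfl⟩
    have := gen_smul_mem_weightSpace false j i hx
    rwa [root_swap j i, add_neg_cancel] at this
  -- Adding all nonzero weight spaces makes this a statement about all words; disjointness removes
  -- them again at the end.
  have htop : Y ⊔ (⨆ ν ≠ 0, weightSpace n M ν) = ⊤ := by
    refine hS _ fun w hwS x hx => ?_
    have hxw := (mem_singularSpace.mp (hX hx)).1
    by_cases h0 : lam + wordWt w ≠ 0
    · exact Submodule.mem_sup_right (Submodule.mem_iSup_of_mem _ (Submodule.mem_iSup_of_mem h0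
        (wordProd_smul_mem_weightSpace hxw w)))
    rw [not_not] at h0
    -- Shorter words are already in the target space, so the letters of `w` may be reordered freely.
    have hperm : ∀ w' : List (Letter n), w.Perm w' →
        wordProd w' • x ∈ Y ⊔ (⨆ ν ≠ 0, weightSpace n M ν) →
        wordProd w • x ∈ Y ⊔ (⨆ ν ≠ 0, weightSpace n M ν) := by
      intro w' hp hw'
      obtain ⟨s, hs⟩ := exists_wordProd_perm hX hod hp
      have := add_mem (hwS (hs x hx)) (Submodule.smul_mem _ s hw')
      rwa [sub_add_cancel] at this
    by_cases hodd : ∀ a ∈ w, a.1.1 = true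
    · by_cases hnd : w.Nodup
      · obtain ⟨I, hI, hIs⟩ := exists_posRoots_sum hodd hnd
        exact absurd ((eq_neg_of_add_eq_zero_left h0).trans hIs) (hlam I hI)
      · rw [List.nodup_iff_sublist] at hnd
        push Not at hnd
        obtain ⟨a, ha⟩ := hnd
        obtain ⟨w', hw'⟩ := ha.exists_perm_append
        -- A repeated odd letter: bring its two copies to the front, where their product is zero.
        refine hperm _ hw' ?_
        have haw : a ∈ w := ha.subset (by simp)
        rw [List.cons_append, List.cons_append, wordProd_cons, wordProd_cons, ← mul_assoc,
          toU_mul_self (hodd a haw), zero_mul, zero_smul]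
        exact zero_mem _
    · push Not at hodd
      obtain ⟨a, ha, hae⟩ := hodd
      have hp := List.perm_cons_erase ha
      -- An even letter moved to the front is the required negative root vector of `gl(n)`; the rest
      -- of the word must have the opposite root as weight.
      refine hperm _ hp (Submodule.mem_sup_left ?_)
      have hwt : wordWt w = wordWt (a :: w.erase a) := (hp.map _).sum_eq
      have hx' := wordProd_smul_mem_weightSpace hxw (w.erase a)
      have hμ : lam + wordWt (w.erase a) = root a.1.2.2 a.1.2.1 := by
        rw [hwt, wordWt_cons, Letter.wt, root_swap] at h0
        linear_combination h0
      rw [hμ] at hx'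
      rw [wordProd_cons, mul_smul, hY]
      refine Submodule.mem_iSup_of_mem a.1.2.2 (Submodule.mem_iSup_of_mem a.1.2.1
        (Submodule.mem_iSup_of_mem a.2 ⟨_, hx', ?_⟩))
      rw [Letter.toU, (Bool.not_eq_true _).mp hae]
      rfl
  intro x hx
  obtain ⟨y, hy, z, hz, rfl⟩ := Submodule.mem_sup.mp (htop ▸ Submodule.mem_top : x ∈ _)
  have hz' : z ∈ weightSpace n M 0 := by simpa using sub_mem hx (hY0 hy)
  rwa [(Submodule.disjoint_def.mp (weightSpace_disjoint 0)) z hz' hz, add_zero]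

end HighestWeight

/-! ### Invertibility of the Casimir element and absence of trivial subquotients -/

section Casimir

set_option linter.unusedSectionVars false

variable {n : ℕ} {M : Type*} [AddCommGroup M] [Module ℂ M] [Module (U n) M]
  [IsScalarTower ℂ (U n) M]

/-- Real weights that pair positively with the sum of the positive roots. -/
def IsPositive (μ : Fin n → ℂ) : Prop := (∀ i, (μ i).im = 0) ∧ 0 < height μ

theorem IsPositive.add_root {μ : Fin n → ℂ} (h : IsPositive μ) {i j : Fin n} (hij : i < j) :
    IsPositive (μ + root i j) := by
  refine ⟨fun k => ?_, ?_⟩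
  · have : ((root i j) k).im = 0 := by
      simp only [root, Pi.sub_apply, Pi.single_apply]
      split_ifs <;> simp
    simp [h.1 k, this]
  · have := height_root_of_lt hij
    have := h.2
    rw [height_add]
    linarith

theorem isPositive_root {i j : Fin n} (hij : i < j) : IsPositive (root i j) := by
  refine ⟨fun k => ?_, ?_⟩
  · simp only [root, Pi.sub_apply, Pi.single_apply]
    split_ifs <;> simp
  · linarith [height_root_of_lt hij]

theorem sum_sub_eq_height (r : Fin n → ℝ) :
    ∑ i, ∑ j, (if i < j then r i - r j else 0) = height (fun i => (r i : ℂ)) := by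
  have e : ∀ i j : Fin n, (if i < j then r i - r j else 0)
      = (if i < j then r i else 0) - (if i < j then r j else 0) := by
    intro i j; split_ifs <;> simp
  simp only [e, Finset.sum_sub_distrib]
  rw [Finset.sum_comm (f := fun i j => if i < j then r j else 0), ← Finset.sum_sub_distrib, height]
  refine Finset.sum_congr rfl fun i _ => ?_
  rw [← Finset.sum_filter, ← Finset.sum_filter, Finset.sum_const, Finset.sum_const,
    Finset.filter_lt_eq_Ioi, Finset.filter_gt_eq_Iio, Fin.card_Ioi, Fin.card_Iio]
  -- The coordinate `r i` enters n - 1 - i times with a plus sign and i times with a minus sign.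
  have : n - 1 - (i : ℕ) + 1 + i = n := by omega
  have h2 : ((n - 1 - (i : ℕ) : ℕ) : ℝ) = n - 1 - i := by
    have : ((n - 1 - (i : ℕ) + 1 + i : ℕ) : ℝ) = n := by rw [this]
    push_cast at this
    linarith
  simp only [nsmul_eq_mul, h2, Complex.ofReal_re]
  ring

/-- The Casimir element acts on a highest weight vector of weight `μ` by `(μ, μ + 2ρ)`. -/
theorem casimir_smul_of_singular {μ : Fin n → ℂ} {x : M} (hx : x ∈ weightSpace n M μ)
    (h0 : ∀ i j : Fin n, i < j → ev (Matrix.single i j (1 : ℂ)) • x = 0) :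
    casimir n • x = (∑ i, μ i ^ 2 + ∑ i, ∑ j, (if i < j then μ i - μ j else 0)) • x := by
  have key : ∀ i j : Fin n, (ev (Matrix.single i j 1) * ev (Matrix.single j i (1 : ℂ))) • x
      = ((if i = j then μ i ^ 2 else 0) + if i < j then μ i - μ j else 0) • x := by
    intro i j
    rcases lt_trichotomy i j with h | rfl | h
    · have := ev_bracket (Matrix.single i j (1 : ℂ)) (Matrix.single j i 1)
      rw [single_mul_single, single_mul_single, if_pos rfl, if_pos rfl, sub_eq_iff_eq_add] at this
      rw [this, ev_sub, add_smul, sub_smul, mul_smul, h0 i j h, smul_zero, add_zero,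
        ev_single_self_smul hx, ev_single_self_smul hx, if_neg h.ne, if_pos h, zero_add, sub_smul]
    · rw [mul_smul, ev_single_self_smul hx, smul_comm, ev_single_self_smul hx]
      simp [pow_two, mul_smul]
    · rw [mul_smul, h0 j i h, smul_zero, if_neg h.ne', if_neg h.not_gt, zero_add, zero_smul]
  rw [casimir, Finset.sum_smul]
  simp only [Finset.sum_smul, key]
  simp only [← Finset.sum_smul, Finset.sum_add_distrib]
  simp

/-- For real μ this is a sum of squares plus the strictly positive height; reality is needed for the
squares to be nonnegative. -/
theorem IsPositive.casimir_eigenvalue_ne_zero {μ : Fin n → ℂ} (h : IsPositive μ) :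
    ∑ i, μ i ^ 2 + ∑ i, ∑ j, (if i < j then μ i - μ j else 0) ≠ 0 := by
  have hr : ∀ i, μ i = ((μ i).re : ℂ) := fun i => Complex.ext rfl (by simp [h.1 i])
  have hpos : 0 < ∑ i, (μ i).re ^ 2
      + ∑ i, ∑ j, (if i < j then (μ i).re - (μ j).re else 0) := by
    rw [sum_sub_eq_height (fun i => (μ i).re), ← funext hr]
    exact add_pos_of_nonneg_of_pos (Finset.sum_nonneg fun i _ => sq_nonneg _) h.2
  have : ∑ i, μ i ^ 2 + ∑ i, ∑ j, (if i < j then μ i - μ j else 0)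
      = ((∑ i, (μ i).re ^ 2 + ∑ i, ∑ j, (if i < j then (μ i).re - (μ j).re else 0) : ℝ) : ℂ) := by
    push_cast
    congr 1
    · exact Finset.sum_congr rfl fun i _ => by rw [← hr]
    · refine Finset.sum_congr rfl fun i _ => Finset.sum_congr rfl fun j _ => ?_
      split_ifs
      · push_cast; rw [← hr, ← hr]
      · simp
  rw [this]
  exact_mod_cast hpos.ne'

theorem casimir_smul_comm (i j : Fin n) (x : M) :
    casimir n • ev (Matrix.single i j (1 : ℂ)) • x
      = ev (Matrix.single i j (1 : ℂ)) • casimir n • x := by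
  rw [← mul_smul, ← mul_smul, (commute_casimir_single i j).eq]

namespace IsHighest

variable {lam : Fin n → ℂ} {v : M}

/-- Raising operators commute with C and preserve positivity, so by induction from above they kill
any kernel vector. It is then singular, and its eigenvalue is nonzero. -/
theorem casimir_injective (hv : IsHighest lam v) {μ : Fin n → ℂ} (hμ : IsPositive μ) {x : M}
    (hx : x ∈ weightSpace n M μ) (h0 : casimir n • x = 0) : x = 0 := by
  obtain ⟨N, hN⟩ := exists_nat_gt (height lam - height μ)
  induction N generalizing μ x with
  | zero =>
    rw [hv.weightSpace_eq_bot (by push_cast at hN; linarith)] at hx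
    exact hx
  | succ N ih =>
    have hs : ∀ i j : Fin n, i < j → ev (Matrix.single i j (1 : ℂ)) • x = 0 := by
      intro i j hij
      refine ih (hμ.add_root hij) (gen_smul_mem_weightSpace false i j hx) ?_ ?_
      · rw [casimir_smul_comm, h0, smul_zero]
      · have := height_root_of_lt hij
        rw [height_add]
        push_cast at hN
        linarith
    rw [casimir_smul_of_singular hx hs] at h0
    exact (smul_eq_zero.mp h0).resolve_left hμ.casimir_eigenvalue_ne_zero

theorem casimir_surjective (hv : IsHighest lam v) {μ : Fin n → ℂ} (hμ : IsPositive μ) {x : M}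
    (hx : x ∈ weightSpace n M μ) : ∃ y ∈ weightSpace n M μ, casimir n • y = x := by
  have := hv.hasFiniteWeightSpaces μ
  have hmap : ∀ y ∈ weightSpace n M μ, act n M (casimir n) y ∈ weightSpace n M μ :=
    fun y hy => casimir_smul_mem_weightSpace hy
  have hinj : Function.Injective ((act n M (casimir n)).restrict hmap) := by
    rw [← LinearMap.ker_eq_bot, LinearMap.ker_eq_bot']
    intro y hy
    exact Subtype.ext (hv.casimir_injective hμ y.2 (congrArg Subtype.val hy))
  obtain ⟨y, hy⟩ := LinearMap.injective_iff_surjective.mp hinj ⟨x, hx⟩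
  exact ⟨y, y.2, congrArg Subtype.val hy⟩

/-- If `lam` is not a sum of distinct positive roots, the Casimir element is invertible on the
weight space of weight zero. -/
theorem casimir_injective_zero (hv : IsHighest lam v)
    (hlam : ∀ I : Finset (Fin n → ℂ), (I : Set (Fin n → ℂ)) ⊆ posRoots n → lam ≠ ∑ α ∈ I, α)
    {x : M} (hx : x ∈ weightSpace n M 0) (h0 : casimir n • x = 0) : x = 0 := by
  have := hv.hasFiniteWeightSpaces 0
  have hmap : ∀ y ∈ weightSpace n M 0, act n M (casimir n) y ∈ weightSpace n M 0 :=
    fun y hy => casimir_smul_mem_weightSpace hy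
  have hsurj : Function.Surjective ((act n M (casimir n)).restrict hmap) := by
    -- The zero weight space comes from the positive root spaces by lowering; C is onto on those and
    -- commutes with lowering.
    have hle : weightSpace n M 0 ≤ (weightSpace n M 0).map (act n M (casimir n)) := by
      refine (hv.weightSpace_zero_le hlam).trans ?_
      refine iSup_le fun i => iSup_le fun j => iSup_le fun hij => ?_
      rintro _ ⟨y, hy, rfl⟩
      obtain ⟨z, hz, rfl⟩ := hv.casimir_surjective (isPositive_root hij) hy
      refine ⟨ev (Matrix.single j i 1) • z, ?_, casimir_smul_comm j i z⟩
      have := gen_smul_mem_weightSpace false j i hz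
      rwa [root_swap j i, add_neg_cancel] at this
    rintro ⟨y, hy⟩
    obtain ⟨z, hz, hzy⟩ := hle hy
    exact ⟨⟨z, hz⟩, Subtype.ext hzy⟩
  have h := LinearMap.injective_iff_surjective.mpr hsurj
  exact congrArg Subtype.val (@h ⟨x, hx⟩ 0 (Subtype.ext (by simpa using h0)))

/-- If `lam` is not a sum of distinct positive roots, the restriction to `gl(n)` has no trivial
subquotient. -/
theorem le_of_trivial_quotient (hv : IsHighest lam v)
    (hlam : ∀ I : Finset (Fin n → ℂ), (I : Set (Fin n → ℂ)) ⊆ posRoots n → lam ≠ ∑ α ∈ I, α)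
    {N N' : Submodule ℂ M} (hN : ∀ A : Gl n, ∀ x ∈ N, ev A • x ∈ N)
    (hle : N ≤ N') (htriv : ∀ A : Gl n, ∀ x ∈ N', ev A • x ∈ N) : N' ≤ N := by
  intro x hx
  -- As `h_0` acts by zero on N'/N, every class has a representative of genuine weight 0.
  obtain ⟨y, hy, hyx⟩ := exists_weight_vector_sub_mem hv.iSup_weightSpace 0 N
    (fun h => hN _) x (fun h => by simpa using htriv _ x hx)
  have hy' : y ∈ N' := by simpa using add_mem (hle hyx) hx
  have hC : ∀ z ∈ N', casimir n • z ∈ N := by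
    intro z hz
    rw [casimir, Finset.sum_smul]
    refine sum_mem fun i _ => ?_
    rw [Finset.sum_smul]
    refine sum_mem fun j _ => ?_
    rw [mul_smul]
    exact hN _ _ (htriv _ z hz)
  have := hv.hasFiniteWeightSpaces 0
  have : FiniteDimensional ℂ ↥(N ⊓ weightSpace n M 0) :=
    Submodule.finiteDimensional_of_le inf_le_right
  have hmap : ∀ z ∈ N ⊓ weightSpace n M 0, act n M (casimir n) z ∈ N ⊓ weightSpace n M 0 :=
    fun z hz => ⟨hC z (hle hz.1), casimir_smul_mem_weightSpace hz.2⟩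
  have hinj : Function.Injective ((act n M (casimir n)).restrict hmap) := by
    rw [← LinearMap.ker_eq_bot, LinearMap.ker_eq_bot']
    intro z hz
    exact Subtype.ext (hv.casimir_injective_zero hlam z.2.2 (congrArg Subtype.val hz))
  -- C maps `y` into N and is bijective on the weight-0 part of N, so C y = C z with z in N;
  -- injectivity on the whole zero weight space then forces y = z.
  obtain ⟨z, hz⟩ := LinearMap.injective_iff_surjective.mp hinj
    ⟨casimir n • y, hC y hy', casimir_smul_mem_weightSpace hy⟩
  have hz' : casimir n • (z : M) = casimir n • y := congrArg Subtype.val hz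
  have hyz : y - z = 0 := hv.casimir_injective_zero hlam (sub_mem hy z.2.2)
    (by rw [smul_sub, hz', sub_self])
  have hyN : y ∈ N := sub_eq_zero.mp hyz ▸ z.2.1
  simpa using sub_mem hyN hyx

end IsHighest

end Casimir

/-! ### Traces on stable subspaces, and the supercharacter at nonzero weights -/

section Supertrace

set_option linter.unusedSectionVars false

variable {n : ℕ} {M : Type*} [AddCommGroup M] [Module ℂ M] [Module (U n) M]
  [IsScalarTower ℂ (U n) M]

/-- The subspace `V` is stable under `u`. -/
abbrev IsStable (V : Submodule ℂ M) (u : U n) : Prop := ∀ x ∈ V, act n M u x ∈ V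

open Classical in
/-- The trace of `u` on a subspace that is stable under `u`. -/
noncomputable def trOn (V : Submodule ℂ M) (u : U n) : ℂ :=
  -- The default 0 lets traces be written and compared without a stability proof in their type.
  if h : IsStable V u then LinearMap.trace ℂ V ((act n M u).restrict h) else 0

theorem trOn_of_isStable {V : Submodule ℂ M} {u : U n} (h : IsStable V u) :
    trOn V u = LinearMap.trace ℂ V ((act n M u).restrict h) := dif_pos h

theorem IsStable.add {V : Submodule ℂ M} {u w : U n} (hu : IsStable V u) (hw : IsStable V w) :
    IsStable V (u + w) := fun x hx => by
  rw [map_add]; exact add_mem (hu x hx) (hw x hx)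

theorem IsStable.smul {V : Submodule ℂ M} {u : U n} (c : ℂ) (hu : IsStable V u) :
    IsStable V (c • u) := fun x hx => by
  rw [map_smul]; exact V.smul_mem c (hu x hx)

theorem IsStable.mul {V : Submodule ℂ M} {u w : U n} (hu : IsStable V u) (hw : IsStable V w) :
    IsStable V (u * w) := fun x hx => by
  rw [map_mul]; exact hu _ (hw x hx)

theorem isStable_zero (V : Submodule ℂ M) : IsStable V (0 : U n) := fun x _ => by simp

theorem isStable_one (V : Submodule ℂ M) : IsStable V (1 : U n) := fun x hx => by simpa

theorem IsStable.pow {V : Submodule ℂ M} {u : U n} (hu : IsStable V u) (k : ℕ) :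
    IsStable V (u ^ k) := by
  induction k with
  | zero => rw [pow_zero]; exact isStable_one V
  | succ k ih => rw [pow_succ]; exact ih.mul hu

theorem IsStable.sum {V : Submodule ℂ M} {ι' : Type*} {s : Finset ι'} {u : ι' → U n}
    (h : ∀ i ∈ s, IsStable V (u i)) : IsStable V (∑ i ∈ s, u i) := fun x hx => by
  rw [map_sum, LinearMap.sum_apply]; exact sum_mem fun i hi => h i hi x hx

theorem trOn_congr {V : Submodule ℂ M} {u w : U n} (h : ∀ x ∈ V, u • x = w • x) :
    trOn V u = trOn V w := by
  have hiff : IsStable V u ↔ IsStable V w :=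
    forall₂_congr fun x hx => by rw [act_apply, act_apply, h x hx]
  by_cases hu : IsStable V u
  · rw [trOn_of_isStable hu, trOn_of_isStable (hiff.mp hu)]
    congr 1
    ext x
    exact h x x.2
  · rw [trOn, trOn, dif_neg hu, dif_neg (mt hiff.mpr hu)]

theorem trOn_add {V : Submodule ℂ M} {u w : U n} (hu : IsStable V u) (hw : IsStable V w) :
    trOn V (u + w) = trOn V u + trOn V w := by
  rw [trOn_of_isStable hu, trOn_of_isStable hw, trOn_of_isStable (hu.add hw), ← map_add]
  congr 1
  ext x
  simp

theorem trOn_smul {V : Submodule ℂ M} {u : U n} (c : ℂ) (hu : IsStable V u) :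
    trOn V (c • u) = c * trOn V u := by
  rw [trOn_of_isStable hu, trOn_of_isStable (hu.smul c), ← smul_eq_mul, ← map_smul]
  congr 1
  ext x
  simp

theorem trOn_zero (V : Submodule ℂ M) : trOn V (0 : U n) = 0 := by
  have := trOn_smul (0 : ℂ) (isStable_zero (n := n) V)
  simpa using this

theorem trOn_sum {V : Submodule ℂ M} {ι' : Type*} {s : Finset ι'} {u : ι' → U n}
    (h : ∀ i ∈ s, IsStable V (u i)) : trOn V (∑ i ∈ s, u i) = ∑ i ∈ s, trOn V (u i) := by
  classical
  induction s using Finset.induction with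
  | empty => simpa using trOn_zero V
  | insert i s hi ih =>
    rw [Finset.sum_insert hi, Finset.sum_insert hi, trOn_add (h i (Finset.mem_insert_self i s))
      (IsStable.sum fun j hj => h j (Finset.mem_insert_of_mem hj)),
      ih fun j hj => h j (Finset.mem_insert_of_mem hj)]

theorem trOn_one (V : Submodule ℂ M) [FiniteDimensional ℂ V] : trOn V (1 : U n) = Module.finrank ℂ V := by
  rw [trOn_of_isStable (isStable_one V), ← LinearMap.trace_id]
  congr 1
  ext x
  simp

theorem trOn_eq_zero_of_eq_bot {V : Submodule ℂ M} (h : V = ⊥) (u : U n) : trOn V u = 0 := by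
  rw [← trOn_zero (n := n) V]
  refine trOn_congr fun x hx => ?_
  rw [h, Submodule.mem_bot] at hx
  simp [hx]

/-- Cyclicity of the trace for maps between two different spaces; it is what relates traces at
neighbouring weights. -/
theorem trOn_mul_comm {V W : Submodule ℂ M} [FiniteDimensional ℂ V] [FiniteDimensional ℂ W]
    {u w : U n} (hu : ∀ x ∈ V, act n M u x ∈ W) (hw : ∀ x ∈ W, act n M w x ∈ V) :
    trOn V (w * u) = trOn W (u * w) := by
  have h1 : IsStable V (w * u) := fun x hx => by rw [map_mul]; exact hw _ (hu x hx)
  have h2 : IsStable W (u * w) := fun x hx => by rw [map_mul]; exact hu _ (hw x hx)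
  rw [trOn_of_isStable h1, trOn_of_isStable h2]
  have := LinearMap.trace_comp_comm' ((act n M u).restrict hu) ((act n M w).restrict hw)
  have e1 : (act n M (w * u)).restrict h1
      = (act n M w).restrict hw ∘ₗ (act n M u).restrict hu := by
    ext x
    simp
  have e2 : (act n M (u * w)).restrict h2
      = (act n M u).restrict hu ∘ₗ (act n M w).restrict hw := by
    ext x
    simp
  rw [e1, e2, this]

theorem mem_even {P : SuperStr n M} {x : M} : x ∈ P.even ↔ P.par x = x := by
  simp [SuperStr.even, sub_eq_zero]

theorem mem_odd {P : SuperStr n M} {x : M} : x ∈ P.odd ↔ P.par x = -x := by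
  simp [SuperStr.odd, add_eq_zero_iff_eq_neg]

theorem ev_smul_mem_even {P : SuperStr n M} (A : Gl n) {x : M} (hx : x ∈ P.even) :
    ev A • x ∈ P.even := by
  rw [mem_even] at hx ⊢
  rw [P.par_ev, hx]

theorem ev_smul_mem_odd {P : SuperStr n M} (A : Gl n) {x : M} (hx : x ∈ P.odd) :
    ev A • x ∈ P.odd := by
  rw [mem_odd] at hx ⊢
  rw [P.par_ev, hx, smul_neg]

/-- The odd Cartan elements make the supercharacter vanish at nonzero weights. -/
theorem sch_eq_zero_of_ne_zero (P : SuperStr n M) (hM : HasFiniteWeightSpaces n M)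
    {μ : Fin n → ℂ} (hμ : μ ≠ 0) : P.sch μ = 0 := by
  obtain ⟨i, hi⟩ := Function.ne_iff.mp hμ
  have := hM μ
  have hw : ∀ x ∈ weightSpace n M μ, od (Matrix.single i i (1 : ℂ)) • x ∈ weightSpace n M μ := by
    intro x hx
    have := gen_smul_mem_weightSpace true i i hx
    rwa [show root i i = 0 by simp [root], add_zero] at this
  have hinj : ∀ x ∈ weightSpace n M μ, od (Matrix.single i i (1 : ℂ)) • x = 0 → x = 0 := by
    intro x hx h
    have h2 := ev_single_self_smul hx i
    rw [← od_single_self_mul, mul_smul, h, smul_zero] at h2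
    exact (smul_eq_zero.mp h2.symm).resolve_left hi
  -- Injectivity gives one inequality of dimensions; using it for both parities gives equality.
  have hle : ∀ V W : Submodule ℂ M,
      (∀ x ∈ V, od (Matrix.single i i (1 : ℂ)) • x ∈ W) →
      Module.finrank ℂ ↥(weightSpace n M μ ⊓ V) ≤ Module.finrank ℂ ↥(weightSpace n M μ ⊓ W) := by
    intro V W h
    have hmap : ∀ x ∈ weightSpace n M μ ⊓ V,
        act n M (od (Matrix.single i i 1)) x ∈ weightSpace n M μ ⊓ W :=
      fun x hx => ⟨hw x hx.1, h x hx.2⟩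
    have : FiniteDimensional ℂ ↥(weightSpace n M μ ⊓ W) :=
      Submodule.finiteDimensional_of_le inf_le_left
    refine LinearMap.finrank_le_finrank_of_injective
      (f := (act n M (od (Matrix.single i i 1))).restrict hmap) ?_
    rw [← LinearMap.ker_eq_bot, LinearMap.ker_eq_bot']
    intro x hx
    exact Subtype.ext (hinj x x.2.1 (congrArg Subtype.val hx))
  have h1 := hle P.even P.odd fun x hx => by
    rw [mem_even] at hx; rw [mem_odd, P.par_od, hx]
  have h2 := hle P.odd P.even fun x hx => by
    rw [mem_odd] at hx; rw [mem_even, P.par_od, hx, smul_neg, neg_neg]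
  rw [SuperStr.sch, le_antisymm h1 h2, sub_self]

/-- Here and below `Y` stands for the even or the odd part, so that each trace identity is proved
once for both. -/
theorem act_single_mem {Y : Submodule ℂ M} (hY : ∀ A : Gl n, ∀ x ∈ Y, ev A • x ∈ Y)
    (i j : Fin n) {μ : Fin n → ℂ} :
    ∀ x ∈ weightSpace n M μ ⊓ Y,
      act n M (ev (Matrix.single i j 1)) x ∈ weightSpace n M (μ + root i j) ⊓ Y :=
  fun x hx => ⟨gen_smul_mem_weightSpace false i j hx.1, hY _ x hx.2⟩

theorem isStable_mul_swap {Y : Submodule ℂ M} (hY : ∀ A : Gl n, ∀ x ∈ Y, ev A • x ∈ Y)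
    (i j : Fin n) (μ : Fin n → ℂ) :
    IsStable (weightSpace n M μ ⊓ Y)
      (ev (Matrix.single i j 1) * ev (Matrix.single j i (1 : ℂ))) := by
  intro x hx
  have := act_single_mem hY i j _ (act_single_mem hY j i x hx)
  rw [root_swap j i, neg_add_cancel_right] at this
  rwa [map_mul]

theorem isStable_casimir {Y : Submodule ℂ M} (hY : ∀ A : Gl n, ∀ x ∈ Y, ev A • x ∈ Y)
    (μ : Fin n → ℂ) : IsStable (weightSpace n M μ ⊓ Y) (casimir n) :=
  IsStable.sum fun i _ => IsStable.sum fun j _ => isStable_mul_swap hY i j μ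

end Supertrace

/-! ### Supertraces of powers of the Casimir element, and the supercharacter at weight zero -/

section Supercharacter

set_option linter.unusedSectionVars false

variable {n : ℕ} {M : Type*} [AddCommGroup M] [Module ℂ M] [Module (U n) M]
  [IsScalarTower ℂ (U n) M]

/-- Cyclicity for E_ij from M_μ to the next weight space, together with the fact that C commutes
with E_ij. -/
theorem trOn_shift {Y : Submodule ℂ M} (hY : ∀ A : Gl n, ∀ x ∈ Y, ev A • x ∈ Y)
    (hM : HasFiniteWeightSpaces n M) (μ : Fin n → ℂ) (i j : Fin n) (k : ℕ) :
    trOn (weightSpace n M μ ⊓ Y)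
        (casimir n ^ k * (ev (Matrix.single j i 1) * ev (Matrix.single i j 1)))
      = trOn (weightSpace n M (μ + root i j) ⊓ Y)
        (casimir n ^ k * (ev (Matrix.single i j 1) * ev (Matrix.single j i 1))) := by
  have := hM μ
  have := hM (μ + root i j)
  have : FiniteDimensional ℂ ↥(weightSpace n M μ ⊓ Y) :=
    Submodule.finiteDimensional_of_le inf_le_left
  have : FiniteDimensional ℂ ↥(weightSpace n M (μ + root i j) ⊓ Y) :=
    Submodule.finiteDimensional_of_le inf_le_left
  rw [← mul_assoc, trOn_mul_comm (W := weightSpace n M (μ + root i j) ⊓ Y) (act_single_mem hY i j),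
    ← mul_assoc, ((commute_casimir_single i j).pow_right k).eq, mul_assoc]
  intro x hx
  rw [map_mul]
  have h := act_single_mem hY j i x hx
  rw [root_swap j i, add_neg_cancel_right] at h
  exact (isStable_casimir hY μ).pow k _ h

/-- The bracket of E_ij and E_ji is E_ii - E_jj, a scalar on the weight space. -/
theorem trOn_swap {Y : Submodule ℂ M} (hY : ∀ A : Gl n, ∀ x ∈ Y, ev A • x ∈ Y)
    (μ : Fin n → ℂ) (i j : Fin n) (k : ℕ) :
    trOn (weightSpace n M μ ⊓ Y)
        (casimir n ^ k * (ev (Matrix.single i j 1) * ev (Matrix.single j i 1)))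
      = trOn (weightSpace n M μ ⊓ Y)
          (casimir n ^ k * (ev (Matrix.single j i 1) * ev (Matrix.single i j 1)))
        + (μ i - μ j) * trOn (weightSpace n M μ ⊓ Y) (casimir n ^ k) := by
  have hC := (isStable_casimir hY μ).pow k
  rw [← trOn_smul _ hC, ← trOn_add (hC.mul (isStable_mul_swap hY j i μ)) (hC.smul _)]
  refine trOn_congr fun x hx => ?_
  have h := ev_bracket (Matrix.single i j (1 : ℂ)) (Matrix.single j i 1)
  rw [single_mul_single, single_mul_single, if_pos rfl, if_pos rfl, ev_sub,
    sub_eq_iff_eq_add'] at h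
  rw [h, mul_add, add_smul, add_smul, mul_smul _ (ev _ - ev _), sub_smul,
    ev_single_self_smul hx.1, ev_single_self_smul hx.1, ← sub_smul, smul_comm, smul_assoc]

theorem trOn_casimir_pow_succ {Y : Submodule ℂ M} (hY : ∀ A : Gl n, ∀ x ∈ Y, ev A • x ∈ Y)
    (μ : Fin n → ℂ) (k : ℕ) :
    trOn (weightSpace n M μ ⊓ Y) (casimir n ^ (k + 1))
      = ∑ i, ∑ j, trOn (weightSpace n M μ ⊓ Y)
          (casimir n ^ k * (ev (Matrix.single i j 1) * ev (Matrix.single j i 1))) := by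
  have hC := (isStable_casimir hY μ).pow k
  have h : ∀ i j, IsStable (weightSpace n M μ ⊓ Y)
      (casimir n ^ k * (ev (Matrix.single i j 1) * ev (Matrix.single j i 1))) :=
    fun i j => hC.mul (isStable_mul_swap hY i j μ)
  have e : casimir n ^ (k + 1) = ∑ i, ∑ j,
      casimir n ^ k * (ev (Matrix.single i j 1) * ev (Matrix.single j i 1)) := by
    rw [pow_succ]
    nth_rewrite 2 [casimir]
    simp only [Finset.mul_sum]
  rw [e, trOn_sum fun i _ => IsStable.sum fun j _ => h i j]
  exact Finset.sum_congr rfl fun i _ => trOn_sum fun j _ => h i j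

theorem trOn_casimir_pow_mul_self {Y : Submodule ℂ M} (hY : ∀ A : Gl n, ∀ x ∈ Y, ev A • x ∈ Y)
    (μ : Fin n → ℂ) (i : Fin n) (k : ℕ) :
    trOn (weightSpace n M μ ⊓ Y)
        (casimir n ^ k * (ev (Matrix.single i i 1) * ev (Matrix.single i i 1)))
      = μ i ^ 2 * trOn (weightSpace n M μ ⊓ Y) (casimir n ^ k) := by
  rw [← trOn_smul _ ((isStable_casimir hY μ).pow k)]
  refine trOn_congr fun x hx => ?_
  rw [mul_smul, mul_smul, ev_single_self_smul hx.1, smul_comm (ev _) (μ i),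
    ev_single_self_smul hx.1, smul_smul, ← pow_two, smul_comm, smul_assoc]

/-- The supertrace of an element of `U(q(n))` on a weight space. -/
noncomputable def strOn (P : SuperStr n M) (μ : Fin n → ℂ) (u : U n) : ℂ :=
  trOn (weightSpace n M μ ⊓ P.even) u - trOn (weightSpace n M μ ⊓ P.odd) u

theorem strOn_one (P : SuperStr n M) (hM : HasFiniteWeightSpaces n M) (μ : Fin n → ℂ) :
    strOn P μ 1 = P.sch μ := by
  have := hM μ
  have : FiniteDimensional ℂ ↥(weightSpace n M μ ⊓ P.even) :=
    Submodule.finiteDimensional_of_le inf_le_left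
  have : FiniteDimensional ℂ ↥(weightSpace n M μ ⊓ P.odd) :=
    Submodule.finiteDimensional_of_le inf_le_left
  rw [strOn, trOn_one, trOn_one, SuperStr.sch]
  push_cast
  rfl

/-- If the supertraces of `C ^ k` vanish at nonzero weights, so do those of the products of `C ^ k`
with the summands of `C` outside the Cartan subalgebra. -/
theorem strOn_mul_eq_zero (P : SuperStr n M) {lam : Fin n → ℂ} {v : M} (hv : IsHighest lam v)
    {k : ℕ} (hk : ∀ μ ≠ 0, strOn P μ (casimir n ^ k) = 0) {i j : Fin n} (hij : i ≠ j)
    (μ : Fin n → ℂ) :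
    strOn P μ (casimir n ^ k * (ev (Matrix.single i j 1) * ev (Matrix.single j i 1))) = 0 := by
  have hM := hv.hasFiniteWeightSpaces
  have he : ∀ A : Gl n, ∀ x ∈ P.even, ev A • x ∈ P.even := fun A _ hx => ev_smul_mem_even A hx
  have ho : ∀ A : Gl n, ∀ x ∈ P.odd, ev A • x ∈ P.odd := fun A _ hx => ev_smul_mem_odd A hx
  have hshift : ∀ μ : Fin n → ℂ, ∀ i j : Fin n,
      strOn P μ (casimir n ^ k * (ev (Matrix.single j i 1) * ev (Matrix.single i j 1)))
      = strOn P (μ + root i j)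
        (casimir n ^ k * (ev (Matrix.single i j 1) * ev (Matrix.single j i 1))) := by
    intro μ i j
    rw [strOn, strOn, trOn_shift he hM, trOn_shift ho hM]
  have hswap : ∀ μ : Fin n → ℂ, ∀ i j : Fin n,
      strOn P μ (casimir n ^ k * (ev (Matrix.single i j 1) * ev (Matrix.single j i 1)))
      = strOn P μ (casimir n ^ k * (ev (Matrix.single j i 1) * ev (Matrix.single i j 1))) := by
    intro μ i j
    have h : strOn P μ (casimir n ^ k * (ev (Matrix.single i j 1) * ev (Matrix.single j i 1)))
      = strOn P μ (casimir n ^ k * (ev (Matrix.single j i 1) * ev (Matrix.single i j 1)))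
        + (μ i - μ j) * strOn P μ (casimir n ^ k) := by
      simp only [strOn]
      rw [trOn_swap he, trOn_swap ho]
      ring
    -- At weight 0 the scalar vanishes, elsewhere the supertrace does; hence no information at
    -- weight 0 is needed.
    have h0 : (μ i - μ j) * strOn P μ (casimir n ^ k) = 0 := by
      by_cases hμ : μ = 0
      · simp [hμ]
      · rw [hk μ hμ, mul_zero]
    rw [h, h0, add_zero]
  have hlt : ∀ i j : Fin n, i < j → ∀ μ : Fin n → ℂ,
      strOn P μ (casimir n ^ k * (ev (Matrix.single j i 1) * ev (Matrix.single i j 1))) = 0 := by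
    intro i j hij μ
    obtain ⟨N, hN⟩ := exists_nat_gt (height lam - height μ)
    induction N generalizing μ with
    | zero =>
      have hb := hv.weightSpace_eq_bot (μ := μ) (by push_cast at hN; linarith)
      rw [strOn, trOn_eq_zero_of_eq_bot (by rw [hb, bot_inf_eq]),
        trOn_eq_zero_of_eq_bot (by rw [hb, bot_inf_eq]), sub_zero]
    | succ N ih =>
      -- The supertrace is unchanged on passing to the weight μ + δ_i - δ_j, and repeated raising
      -- ends in a zero weight space.
      rw [hshift, hswap]
      refine ih _ ?_
      have := height_root_of_lt hij
      rw [height_add]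
      push_cast at hN
      linarith
  rcases hij.lt_or_gt with h | h
  · rw [hswap]; exact hlt i j h μ
  · exact hlt j i h μ

/-- Expanding one factor C, the diagonal terms contribute μ_i² str(C^k), which vanishes at μ = 0
because of μ_i and elsewhere by induction. The induction starts from the vanishing of the
supercharacter at nonzero weights. -/
theorem strOn_casimir_pow_succ (P : SuperStr n M) {lam : Fin n → ℂ} {v : M}
    (hv : IsHighest lam v) (k : ℕ) (μ : Fin n → ℂ) : strOn P μ (casimir n ^ (k + 1)) = 0 := by
  have he : ∀ A : Gl n, ∀ x ∈ P.even, ev A • x ∈ P.even := fun A _ hx => ev_smul_mem_even A hx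
  have ho : ∀ A : Gl n, ∀ x ∈ P.odd, ev A • x ∈ P.odd := fun A _ hx => ev_smul_mem_odd A hx
  have step : ∀ k, (∀ μ ≠ 0, strOn P μ (casimir n ^ k) = 0) →
      ∀ μ, strOn P μ (casimir n ^ (k + 1)) = 0 := by
    intro k hk μ
    rw [strOn, trOn_casimir_pow_succ he, trOn_casimir_pow_succ ho, ← Finset.sum_sub_distrib]
    refine Finset.sum_eq_zero fun i _ => ?_
    rw [← Finset.sum_sub_distrib]
    refine Finset.sum_eq_zero fun j _ => ?_
    by_cases hij : i = j
    · subst hij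
      rw [trOn_casimir_pow_mul_self he, trOn_casimir_pow_mul_self ho, ← mul_sub]
      by_cases hμ : μ = 0
      · simp [hμ]
      · exact mul_eq_zero_of_right _ (hk μ hμ)
    · exact strOn_mul_eq_zero P hv hk hij μ
  induction k generalizing μ with
  | zero =>
    refine step 0 (fun μ hμ => ?_) μ
    rw [pow_zero, strOn_one P hv.hasFiniteWeightSpaces,
      sch_eq_zero_of_ne_zero P hv.hasFiniteWeightSpaces hμ, Int.cast_zero]
  | succ k ih => exact step (k + 1) (fun μ _ => ih μ) μ

theorem isStable_aeval {V : Submodule ℂ M} {u : U n} (hu : IsStable V u) (p : Polynomial ℂ) :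
    IsStable V (Polynomial.aeval u p) := by
  rw [Polynomial.aeval_eq_sum_range]
  exact IsStable.sum fun i _ => (hu.pow i).smul _

/-- Only the constant term survives, since positive powers of C have supertrace zero. -/
theorem strOn_aeval_casimir (P : SuperStr n M) {lam : Fin n → ℂ} {v : M}
    (hv : IsHighest lam v) (p : Polynomial ℂ) (μ : Fin n → ℂ) :
    strOn P μ (Polynomial.aeval (casimir n) p) = p.coeff 0 * P.sch μ := by
  have he := isStable_casimir (Y := P.even) (fun A _ hx => ev_smul_mem_even A hx) μ
  have ho := isStable_casimir (Y := P.odd) (fun A _ hx => ev_smul_mem_odd A hx) μ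
  induction p using Polynomial.induction_on' with
  | add p q hp hq =>
    rw [Polynomial.coeff_add, add_mul, ← hp, ← hq, map_add]
    simp only [strOn]
    rw [trOn_add (isStable_aeval he p) (isStable_aeval he q),
      trOn_add (isStable_aeval ho p) (isStable_aeval ho q)]
    ring
  | monomial k a =>
    have h : strOn P μ (Polynomial.aeval (casimir n) (Polynomial.monomial k a))
        = a * strOn P μ (casimir n ^ k) := by
      rw [Polynomial.aeval_monomial, ← Algebra.smul_def, strOn, trOn_smul _ (he.pow k),
        trOn_smul _ (ho.pow k), strOn, mul_sub]
    rw [h]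
    cases k with
    | zero => rw [pow_zero, strOn_one P hv.hasFiniteWeightSpaces]; simp
    | succ k => rw [strOn_casimir_pow_succ P hv, Polynomial.coeff_monomial]; simp

/-- The supercharacter of a highest weight module vanishes if its highest weight is not a sum of
distinct positive roots. -/
theorem IsHighest.sch_eq_zero {lam : Fin n → ℂ} {v : M} (hv : IsHighest lam v)
    (hlam : ∀ I : Finset (Fin n → ℂ), (I : Set (Fin n → ℂ)) ⊆ posRoots n → lam ≠ ∑ α ∈ I, α)
    (P : SuperStr n M) : P.sch = 0 := by
  funext μ
  by_cases hμ : μ ≠ 0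
  · exact sch_eq_zero_of_ne_zero P hv.hasFiniteWeightSpaces hμ
  rw [not_not] at hμ
  subst hμ
  have := hv.hasFiniteWeightSpaces 0
  have hmap : IsStable (weightSpace n M 0) (casimir n) := fun y hy => casimir_smul_mem_weightSpace hy
  set T := (act n M (casimir n)).restrict hmap with hT
  have hinj : Function.Injective T := by
    rw [← LinearMap.ker_eq_bot, LinearMap.ker_eq_bot']
    intro y hy
    exact Subtype.ext (hv.casimir_injective_zero hlam y.2 (congrArg Subtype.val hy))
  -- Invertibility of C on the zero weight space enters here: the constant term of its minimal
  -- polynomial can be cancelled.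
  have hp0 := LinearMap.minpoly_coeff_zero_of_injective hinj
  have haeval : ∀ (p : Polynomial ℂ) (y : weightSpace n M 0),
      ((Polynomial.aeval T p y : weightSpace n M 0) : M)
        = Polynomial.aeval (casimir n) p • (y : M) := by
    intro p y
    have hpow : ∀ k, (((T ^ k) y : weightSpace n M 0) : M) = casimir n ^ k • (y : M) := by
      intro k
      induction k with
      | zero => simp
      | succ k ih => rw [pow_succ', pow_succ', mul_smul, ← ih]; rfl
    rw [Polynomial.aeval_eq_sum_range, Polynomial.aeval_eq_sum_range, Finset.sum_smul,
      LinearMap.sum_apply, Submodule.coe_sum]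
    refine Finset.sum_congr rfl fun k _ => ?_
    rw [LinearMap.smul_apply, Submodule.coe_smul, hpow, smul_assoc]
  have hz : ∀ y ∈ weightSpace n M 0,
      Polynomial.aeval (casimir n) (minpoly ℂ T) • y = (0 : U n) • y := by
    intro y hy
    rw [← haeval _ ⟨y, hy⟩, minpoly.aeval, zero_smul]
    rfl
  have h := strOn_aeval_casimir P hv (minpoly ℂ T) 0
  rw [strOn, trOn_congr (V := weightSpace n M 0 ⊓ P.even) (fun x hx => hz x hx.1),
    trOn_congr (V := weightSpace n M 0 ⊓ P.odd) (fun x hx => hz x hx.1), trOn_zero,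
    trOn_zero, sub_zero] at h
  exact_mod_cast (mul_eq_zero.mp h.symm).resolve_left hp0

end Supercharacter

/-! ### The modules `L(λ)`, irreducible objects of `𝒪`, and finiteness of the exceptional set -/

section Irreducible

set_option linter.unusedSectionVars false

variable {n : ℕ}

theorem gen_single_smul_eq_zero_of_upper {M : Type*} [AddCommGroup M] [Module (U n) M] {x : M}
    (h : ∀ A : Gl n, (∀ i j, j ≤ i → A i j = 0) → ev A • x = 0 ∧ od A • x = 0)
    (b : Bool) (i j : Fin n) (hij : i < j) : gen b (Matrix.single i j (1 : ℂ)) • x = 0 := by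
  have hA : ∀ k l : Fin n, l ≤ k → Matrix.single i j (1 : ℂ) k l = 0 := by
    intro k l hlk
    refine Matrix.single_apply_of_ne _ _ _ _ _ ?_
    rintro ⟨rfl, rfl⟩
    exact absurd hij hlk.not_gt
  cases b
  exacts [(h _ hA).1, (h _ hA).2]

theorem isHighest_L (lam : Fin n → ℂ) (H : Submodule ℂ (Fin n → ℂ)) :
    IsHighest lam (Submodule.Quotient.mk (Submodule.Quotient.mk 1) : L n lam H) := by
  have h0 : ∀ u : U n, u ∈ vermaIdeal n lam H →
      u • (Submodule.Quotient.mk (Submodule.Quotient.mk 1) : L n lam H) = 0 := by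
    intro u hu
    rw [← Submodule.Quotient.mk_smul, ← Submodule.Quotient.mk_smul, smul_eq_mul, mul_one,
      (Submodule.Quotient.mk_eq_zero _).mpr hu, Submodule.Quotient.mk_zero]
  refine ⟨mem_singularSpace.mpr ⟨fun h => ?_, gen_single_smul_eq_zero_of_upper fun A hA => ⟨h0 _ ?_, h0 _ ?_⟩⟩, ?_⟩
  · have := h0 _ (Submodule.subset_span (Or.inl (Or.inr ⟨h, rfl⟩)))
    rwa [sub_smul, algebraMap_smul, sub_eq_zero] at this
  · exact Submodule.subset_span (Or.inl (Or.inl ⟨A, hA, Or.inl rfl⟩))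
  · exact Submodule.subset_span (Or.inl (Or.inl ⟨A, hA, Or.inr rfl⟩))
  · refine Submodule.eq_top_iff'.mpr fun y => ?_
    obtain ⟨y, rfl⟩ := Submodule.Quotient.mk_surjective _ y
    obtain ⟨u, rfl⟩ := Submodule.Quotient.mk_surjective _ y
    refine Submodule.mem_span_singleton.mpr ⟨u, ?_⟩
    rw [← Submodule.Quotient.mk_smul, ← Submodule.Quotient.mk_smul, smul_eq_mul, mul_one]

theorem multiplicity_trivial_eq_zero {lam : Fin n → ℂ}
    (hlam : ∀ I : Finset (Fin n → ℂ), (I : Set (Fin n → ℂ)) ⊆ posRoots n → lam ≠ ∑ α ∈ I, α)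
    (H : Submodule ℂ (Fin n → ℂ)) : multiplicity (Gl n) (L n lam H) (TrivialGl n) = 0 := by
  rw [multiplicity]
  refine le_antisymm (iSup₂_le fun k c => ?_) bot_le
  -- A trivial step of a chain would be killed by `gl(n)`, so its two terms would coincide and the
  -- quotient would be zero, not ℂ.
  have : IsEmpty {i : Fin k // Nonempty
      ((↥(c i.succ) ⧸ (c i.castSucc).comap (c i.succ).incl) ≃ₗ⁅ℂ, Gl n⁆ TrivialGl n)} := by
    refine ⟨fun ⟨i, ⟨e⟩⟩ => ?_⟩
    have hle : c i.castSucc ≤ c i.succ := c.monotone i.castSucc_lt_succ.le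
    have htriv : ∀ A : Gl n, ∀ x ∈ c i.succ, ⁅A, x⁆ ∈ c i.castSucc := by
      intro A x hx
      have h1 : ⁅A, LieSubmodule.Quotient.mk' ((c i.castSucc).comap (c i.succ).incl) ⟨x, hx⟩⁆
          = 0 := by
        apply e.injective
        rw [map_zero]
        exact LieModuleHom.map_lie e.toLieModuleHom A _
      rw [← LieModuleHom.map_lie] at h1
      exact LieSubmodule.mem_comap.mp
        ((LieSubmodule.Quotient.mk_eq_zero ((c i.castSucc).comap (c i.succ).incl)).mp h1)
    have hge : (c i.succ).toSubmodule ≤ (c i.castSucc).toSubmodule :=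
      (isHighest_L lam H).le_of_trivial_quotient hlam
        (fun A x hx => (c i.castSucc).lie_mem hx) hle htriv
    have hz : ∀ y : ↥(c i.succ) ⧸ (c i.castSucc).comap (c i.succ).incl, y = 0 := by
      intro y
      obtain ⟨x, rfl⟩ := LieSubmodule.Quotient.surjective_mk' _ y
      exact (LieSubmodule.Quotient.mk_eq_zero _).mpr (hge x.2)
    have h1 : (1 : ℂ) = 0 := by
      have := congrArg e (hz (e.symm (1 : ℂ)))
      rw [map_zero] at this
      exact (e.apply_symm_apply (1 : ℂ)).symm.trans this
    exact one_ne_zero h1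
  rw [Nat.card_of_isEmpty]
  rfl

variable {M : Type*} [AddCommGroup M] [Module ℂ M] [Module (U n) M] [IsScalarTower ℂ (U n) M]

/-- A nonzero module in the category `𝒪` has a highest weight vector. -/
theorem InO.exists_singular [Nontrivial M] (hO : InO n M) :
    ∃ lam, ∃ v ∈ singularSpace n M lam, v ≠ 0 := by
  obtain ⟨μ, x, hx, hx0⟩ : ∃ μ, ∃ x ∈ weightSpace n M μ, x ≠ 0 := by
    by_contra! h
    have : (⨆ μ : Fin n → ℂ, weightSpace n M μ) = ⊥ :=
      iSup_eq_bot.mpr fun μ => (Submodule.eq_bot_iff _).mpr (h μ)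
    exact bot_ne_top (this.symm.trans hO.semisimple)
  obtain ⟨W, hxW, hfd, hW⟩ := hO.locallyFinite x
  -- The Cartan element whose eigenvalue on a weight vector has the height as real part. On the
  -- finite-dimensional `W` it has finitely many eigenvalues, so a weight vector of maximal height
  -- exists.
  set d : Fin n → ℂ := fun i => ((n : ℝ) - 1 - 2 * (i : ℕ) : ℝ) with hd
  have hdiag : ∀ i j : Fin n, j < i → Matrix.diagonal d i j = 0 := fun i j h =>
    Matrix.diagonal_apply_ne _ h.ne'
  set T : Module.End ℂ W := (act n M (ev (Matrix.diagonal d))).restrict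
    (fun w hw => (hW _ hdiag w hw).1) with hT
  have hht : ∀ ν : Fin n → ℂ, (∑ i, d i * ν i).re = height ν := by
    intro ν
    simp only [Complex.re_sum, height, hd, Complex.re_ofReal_mul]
  have hfin : {r : ℝ | ∃ ν, ∃ y ∈ weightSpace n M ν, y ∈ W ∧ y ≠ 0 ∧ height ν = r}.Finite := by
    refine (T.finite_hasEigenvalue.image Complex.re).subset ?_
    rintro _ ⟨ν, y, hy, hyW, hy0, rfl⟩
    refine ⟨∑ i, d i * ν i, ?_, hht ν⟩
    refine Module.End.hasEigenvalue_of_hasEigenvector (x := ⟨y, hyW⟩) ⟨?_, ?_⟩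
    · rw [Module.End.mem_eigenspace_iff]
      exact Subtype.ext (hy d)
    · exact fun h => hy0 (congrArg Subtype.val h)
  obtain ⟨r, ⟨ν, y, hy, hyW, hy0, rfl⟩, hmax⟩ :=
    Set.exists_max_image _ id hfin ⟨_, μ, x, hx, hxW, hx0, rfl⟩
  refine ⟨ν, y, mem_singularSpace.mpr ⟨hy, fun b i j hij => ?_⟩, hy0⟩
  by_contra hne
  have hup : ∀ k l : Fin n, l < k → Matrix.single i j (1 : ℂ) k l = 0 := by
    intro k l hlk
    refine Matrix.single_apply_of_ne _ _ _ _ _ ?_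
    rintro ⟨rfl, rfl⟩
    exact absurd hij hlk.not_gt
  have hmem : gen b (Matrix.single i j (1 : ℂ)) • y ∈ W := by
    cases b
    exacts [(hW _ hup y hyW).1, (hW _ hup y hyW).2]
  -- A nonzero raised vector would lie in `W` with larger height.
  have := hmax _ ⟨_, _, gen_smul_mem_weightSpace b i j hy, hmem, hne, rfl⟩
  have h1 := height_root_of_lt hij
  simp only [id, height_add] at this
  linarith

theorem par_mem_singularSpace (P : SuperStr n M) {lam : Fin n → ℂ} {v : M}
    (hv : v ∈ singularSpace n M lam) : P.par v ∈ singularSpace n M lam := by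
  rw [mem_singularSpace] at hv ⊢
  refine ⟨fun h => by rw [← P.par_ev, hv.1 h, map_smul], fun b i j hij => ?_⟩
  cases b
  · rw [gen_false, ← P.par_ev, ← gen_false, hv.2 _ _ _ hij, map_zero]
  · rw [gen_true, ← neg_eq_zero, ← P.par_od, ← gen_true, hv.2 _ _ _ hij, map_zero]

/-- A homogeneous vector generates a graded submodule. -/
theorem isGraded_span_singleton (P : SuperStr n M) {v : M} {c : ℂ} (hv : P.par v = c • v) :
    P.IsGraded (Submodule.span (U n) {v}) := by
  set S : Submodule ℂ M := (Submodule.span (U n) {v}).restrictScalars ℂ with hS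
  -- The vectors of the submodule whose parity image stays in it form a q(n)-stable space, so it is
  -- enough to test the generator.
  have hstab : ∀ b (A : Gl n), ∀ x ∈ S ⊓ S.comap P.par, gen b A • x ∈ S ⊓ S.comap P.par := by
    rintro b A x ⟨hx, hx'⟩
    refine ⟨Submodule.smul_mem (Submodule.span (U n) {v}) _ hx, ?_⟩
    change P.par (gen b A • x) ∈ Submodule.span (U n) {v}
    have hx'' : P.par x ∈ Submodule.span (U n) {v} := hx'
    cases b
    · rw [gen_false, P.par_ev]
      exact Submodule.smul_mem _ _ hx''
    · rw [gen_true, P.par_od]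
      exact neg_mem (Submodule.smul_mem _ _ hx'')
  have hvS : v ∈ S := Submodule.mem_span_singleton_self v
  intro m hm
  obtain ⟨u, rfl⟩ := Submodule.mem_span_singleton.mp hm
  refine (smul_mem_of_gen hstab u ⟨hvS, ?_⟩).2
  change P.par v ∈ S
  rw [hv]
  exact S.smul_mem c hvS

theorem SuperStr.IsIrreducible.exists_isHighest {P : SuperStr n M} (hP : P.IsIrreducible)
    (hO : InO n M) : ∃ (lam : Fin n → ℂ) (v : M), v ≠ 0 ∧ IsHighest lam v := by
  have := hP.1
  obtain ⟨lam, v, hv, hv0⟩ := hO.exists_singular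
  have hpar := par_mem_singularSpace P hv
  obtain ⟨w, c, hw, hw0, hc⟩ : ∃ (w : M) (c : ℂ), w ∈ singularSpace n M lam ∧ w ≠ 0 ∧
      P.par w = c • w := by
    -- A homogeneous singular vector: twice the even component of `v`, or `v` itself when that
    -- component vanishes.
    by_cases h : v + P.par v = 0
    · exact ⟨v, -1, hv, hv0, by rw [neg_one_smul]; exact eq_neg_of_add_eq_zero_right h⟩
    · exact ⟨v + P.par v, 1, add_mem hv hpar, h, by
        rw [map_add, P.par_par, one_smul, add_comm]⟩
  refine ⟨lam, w, hw0, hw, (hP.2 _ (isGraded_span_singleton P hc)).resolve_left fun h => hw0 ?_⟩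
  exact Submodule.span_singleton_eq_bot.mp h

theorem gen_smul_eq_zero_of_upper {x : M}
    (h : ∀ (b : Bool) (i j : Fin n), i < j → gen b (Matrix.single i j (1 : ℂ)) • x = 0)
    (b : Bool) {A : Gl n} (hA : ∀ i j, j ≤ i → A i j = 0) : gen b A • x = 0 := by
  rw [Matrix.matrix_eq_sum_single A]
  simp only [map_sum, Finset.sum_smul]
  refine Finset.sum_eq_zero fun i _ => Finset.sum_eq_zero fun j _ => ?_
  have e : Matrix.single i j (A i j) = A i j • Matrix.single i j (1 : ℂ) := by simp
  rw [e, map_smul, smul_assoc]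
  rcases le_or_gt j i with hji | hij
  · rw [hA i j hji, zero_smul]
  · rw [h b i j hij, smul_zero]

theorem IsHighest.hasHighestWeight {lam : Fin n → ℂ} {v : M} (hv : IsHighest lam v)
    (hv0 : v ≠ 0) : HasHighestWeight n M lam := by
  have h := mem_singularSpace.mp hv.mem
  exact ⟨v, h.1, hv0, fun A hA =>
    ⟨gen_smul_eq_zero_of_upper h.2 false hA, gen_smul_eq_zero_of_upper h.2 true hA⟩⟩

theorem finite_posRoots_sums (n : ℕ) :
    {lam : Fin n → ℂ | ∃ I : Finset (Fin n → ℂ), (I : Set (Fin n → ℂ)) ⊆ posRoots n ∧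
      lam = ∑ α ∈ I, α}.Finite := by
  have hfin : (posRoots n).Finite := by
    refine (Set.finite_range fun p : Fin n × Fin n => root p.1 p.2).subset ?_
    rintro _ ⟨i, j, _, rfl⟩
    exact ⟨(i, j), rfl⟩
  refine (hfin.toFinset.powerset.finite_toSet.image fun I => ∑ α ∈ I, α).subset ?_
  rintro _ ⟨I, hI, rfl⟩
  refine ⟨I, ?_, rfl⟩
  simpa [← Finset.coe_subset] using hI

end Irreducible

end Queer

/-! ### Assembly of the theorem -/

theorem lemma3p5 (n : ℕ) :
    (∀ lam : Fin n → ℂ,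
      (∀ I : Finset (Fin n → ℂ), (I : Set (Fin n → ℂ)) ⊆ Queer.posRoots n → lam ≠ ∑ α ∈ I, α) →
      ∀ H : Submodule ℂ (Fin n → ℂ), Maximal (Queer.IsIsotropic lam) H →
        Queer.multiplicity (Queer.Gl n) (Queer.L n lam H) (Queer.TrivialGl n) = 0 ∧
        Queer.HasFiniteWeightSpaces n (Queer.L n lam H) ∧
        (Queer.LSuper n lam H).sch = 0) ∧
    {lam : Fin n → ℂ | ¬ Queer.GGM n lam}.Finite ∧
    (∃ S : Set (Fin n → ℂ), S.Finite ∧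
      ∀ (M : Type*) [AddCommGroup M] [Module ℂ M] [Module (Queer.U n) M]
        [IsScalarTower ℂ (Queer.U n) M] (P : Queer.SuperStr n M),
        Queer.InO n M → P.IsIrreducible →
        (∃ lam ∈ S, Queer.HasHighestWeight n M lam) ∨
        (Queer.HasFiniteWeightSpaces n M ∧ P.sch = 0)) := by
  refine ⟨fun lam hlam H _ => ⟨Queer.multiplicity_trivial_eq_zero hlam H,
    (Queer.isHighest_L lam H).hasFiniteWeightSpaces,
    (Queer.isHighest_L lam H).sch_eq_zero hlam _⟩, ?_, _, Queer.finite_posRoots_sums n, ?_⟩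
  -- The conjecture can fail only at sums of distinct positive roots. The same finite set serves as
  -- `S` for the irreducible objects.
  · refine (Queer.finite_posRoots_sums n).subset fun lam hlam => ?_
    by_contra hne
    refine hlam fun _ H _ => ⟨(Queer.isHighest_L lam H).hasFiniteWeightSpaces,
      (Queer.isHighest_L lam H).sch_eq_zero (fun I hI h => hne ⟨I, hI, h⟩) _⟩
  · intro M _ _ _ _ P hO hP
    obtain ⟨lam, v, hv0, hv⟩ := hP.exists_isHighest hO
    by_cases h : ∃ I : Finset (Fin n → ℂ), (I : Set (Fin n → ℂ)) ⊆ Queer.posRoots n ∧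
        lam = ∑ α ∈ I, α
    · exact Or.inl ⟨lam, h, hv.hasHighestWeight hv0⟩
    · exact Or.inr ⟨hv.hasFiniteWeightSpaces,
        hv.sch_eq_zero (fun I hI he => h ⟨I, hI, he⟩) P⟩
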